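/- Let $N\ge 1$, and let $x_1,\dots,x_n$ denote the subvectors of $x\in\mathbb R^N$ given by a fixed partition of its coordinates into $n$ blocks, of dimensions $N_1,\dots,N_n$. Let $F=f+g$, where $f:\mathbb R^N\to\mathbb R\cup\{\infty\}$ is standard self-concordant, i.e. closed convex with open domain, three times continuously differentiable there, and $|\psi'''(0)|\le 2\,\psi''(0)^{3/2}$ for $\psi(t)=f(x+tu)$, for all $x\in\mathrm{dom}(f)$, $u\in\mathbb R^N$; and $g(x)=\sum_{i=1}^n g_i(x_i)$ with each $g_i:\mathbb R^{N_i}\to\mathbb R\cup\{\infty\}$ proper closed convex. Assume that $\nabla^2 f$ is positive definite on $\mathrm{dom}(F)$ and that $F$ has a unique minimizer; put $F^*=\min F$. Write $\nabla_i f$ and $\nabla^2_{ii}f$ for the subvector and the diagonal submatrix belonging to block $i$, and $\|u\|_M=\sqrt{\langle u,Mu\rangle}$, $\|v\|_M^*=\sqrt{\langle v,M^{-1}v\rangle}$ for $M$ symmetric positive definite. Let $x^0\in\mathrm{dom}(F)$, $\eta\in[0,1/4]$, $p_i>0$ with $\sum_{i=1}^n p_i=1$, and let $\{x^k\}$ be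 generated by the randomized block proximal damped Newton method (RBPDN): at step $k$ a block $i$ is picked with probability $p_i$, independently of the earlier picks; then (depending only on the picks made so far) one takes some $d_i=d_i(x^k)\in\mathbb R^{N_i}$ for which there is $v_i$ with $$-v_i\in\nabla_i f(x^k)+\nabla^2_{ii}f(x^k)d_i+\partial g_i(x^k_i+d_i),\qquad \|v_i\|^*_{\nabla^2_{ii}f(x^k)}\le\eta\,\|d_i\|_{\nabla^2_{ii}f(x^k)},$$ and sets $x^{k+1}_i=x^k_i+d_i/(1+\|d_i\|_{\nabla^2_{ii}f(x^k)})$ and $x^{k+1}_j=x^k_j$ for $j\ne i$. Let $S=\{x: F(x)\le F(x^0)\}$, and suppose that $g$ is Lipschitz differentiable on $S$ with constant $L_g\ge 0$: at each point of $S$, $g$ is finite in a neighbourhood and differentiable, and $\|\nabla g(x)-\nabla g(y)\|\le L_g\|x-y\|$ for $x,y\in S$. Let $$\sigma_f=\min_{x\in S}\lambda_{\min}(\nabla^2 f(x)),\qquad L_f=\max_{x\in S}\|\nabla^2 f(x)\|,$$ $$c_1=\frac{1-\eta}{\sqrt n\,\max_{x\in S}\left\{(1+\eta)\|H(x)^{1/2}(\nabla^2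 f(x))^{-1/2}\|+\|H(x)^{-1/2}(\nabla^2 f(x))^{1/2}\|\right\}},$$ where $H(x)=\mathrm{Diag}(\nabla^2_{11}f(x),\dots,\nabla^2_{nn}f(x))$ and $\|\cdot\|$ is the spectral norm. Let $p_{\min}=\min_i p_i$, $\delta_0=F(x^0)-F^*$, let $\omega_*^{-1}$ be the inverse of $\omega_*(t)=-t-\ln(1-t)$ restricted to $[0,1)$, and put $$\tilde c_4=\frac{\sqrt n\,c_1\sigma_f}{(1-\eta)(L_f+L_g)},\qquad q=1-\frac{\tilde c_4^2\,p_{\min}^2\,(1-\omega_*^{-1}(\delta_0))}{2\,(1+\tilde c_4\,p_{\min}\,\omega_*^{-1}(\delta_0))}.$$ Then RBPDN converges globally linearly in expectation: $q\in(0,1)$, and for all $k\ge 0$ the value $F(x^k)$ is always finite, $F(x^k)-F^*$ is integrable, and $$\mathbb E[F(x^k)-F^*]\le q^k\,(F(x^0)-F^*).$$ -/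

import Mathlib

open Set MeasureTheory ProbabilityTheory
open scoped MatrixOrder

noncomputable section

namespace RBPDN

/-! ### Extended-real-valued functions -/

/-- The (effective) domain of an extended-real-valued function that never takes the value `-∞`. -/
def dom {V : Type*} (h : V → EReal) : Set V := {x | h x ≠ ⊤}

/-- The real-valued function underlying `h`; it is meaningful on `dom h` only. -/
def re {V : Type*} (h : V → EReal) : V → ℝ := fun x => (h x).toReal

/-- Proper closed convex functions `V → ℝ ∪ {∞}`. -/
structure IsProperClosedConvex {V : Type*} [NormedAddCommGroup V] [NormedSpace ℝ V]
    (h : V → EReal) : Prop where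
  ne_bot : ∀ x, h x ≠ ⊥
  proper : (dom h).Nonempty
  closed : LowerSemicontinuous h
  convex : ConvexOn ℝ (dom h) (re h)

/-- Self-concordant functions with parameter `M`: closed convex functions with (nonempty) open
domain which are three times continuously differentiable there and satisfy
`|ψ'''(0)| ≤ M ψ''(0) ^ (3/2)` for `ψ(t) = h (x + t u)`, whenever `x ∈ dom h`. -/
structure IsSelfConcordant {V : Type*} [NormedAddCommGroup V] [NormedSpace ℝ V]
    (M : ℝ) (h : V → EReal) : Prop extends IsProperClosedConvex h where
  isOpen_dom : IsOpen (dom h)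
  contDiffOn : ContDiffOn ℝ 3 (re h) (dom h)
  third_deriv_le : ∀ x ∈ dom h, ∀ u : V,
    |iteratedDeriv 3 (fun t : ℝ => re h (x + t • u)) 0| ≤
      M * (iteratedDeriv 2 (fun t : ℝ => re h (x + t • u)) 0) ^ (3 / 2 : ℝ)

/-- The convex subdifferential (it is empty outside the domain of a proper function). -/
def subdiff {V : Type*} [NormedAddCommGroup V] [InnerProductSpace ℝ V]
    (h : V → EReal) (x : V) : Set V :=
  {s | ∀ y, h x + ((inner ℝ s (y - x) : ℝ) : EReal) ≤ h y}

/-- `h` is Lipschitz differentiable on `S` with constant `L`: at every point of `S` it is finite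
near that point and differentiable, and the gradient is `L`-Lipschitz on `S`. -/
structure IsLipschitzDifferentiableOn {V : Type*} [NormedAddCommGroup V]
    [InnerProductSpace ℝ V] [CompleteSpace V] (L : ℝ) (h : V → EReal) (S : Set V) : Prop where
  subset_interior_dom : S ⊆ interior (dom h)
  differentiableAt : ∀ x ∈ S, DifferentiableAt ℝ (re h) x
  lipschitz : ∀ x ∈ S, ∀ y ∈ S, ‖gradient (re h) x - gradient (re h) y‖ ≤ L * ‖x - y‖

/-! ### Matrices, weighted norms -/

/-- The weighted norm `‖u‖_M = √⟨u, M u⟩`; the dual norm is `weightedNorm M⁻¹`. -/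
def weightedNorm {ι : Type*} [Fintype ι] [DecidableEq ι] (M : Matrix ι ι ℝ)
    (u : EuclideanSpace ℝ ι) : ℝ :=
  Real.sqrt (inner ℝ u (Matrix.toEuclideanLin M u))

/-- The spectral norm. -/
def spectralNorm {ι : Type*} [Fintype ι] [DecidableEq ι] (M : Matrix ι ι ℝ) : ℝ :=
  ‖Matrix.toEuclideanCLM (n := ι) (𝕜 := ℝ) M‖

/-- The smallest eigenvalue. -/
def lambdaMin {ι : Type*} [Fintype ι] [DecidableEq ι] (M : Matrix ι ι ℝ) : ℝ :=
  sInf {μ | Module.End.HasEigenvalue (Matrix.toLin' M) μ}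

/-- The Hessian matrix of `h` at `x`. -/
def hessian {N : ℕ} (h : EuclideanSpace ℝ (Fin N) → ℝ) (x : EuclideanSpace ℝ (Fin N)) :
    Matrix (Fin N) (Fin N) ℝ :=
  Matrix.of fun j k =>
    iteratedFDeriv ℝ 2 h x ![EuclideanSpace.single j 1, EuclideanSpace.single k 1]

/-! ### Blocks

A partition of the `N` coordinates into `n` blocks is given by the map `b : Fin N → Fin n` which
sends each coordinate to its block. -/

/-- The space of the `i`-th block. -/
abbrev Block {N n : ℕ} (b : Fin N → Fin n) (i : Fin n) : Type :=
  EuclideanSpace ℝ {j : Fin N // b j = i}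

/-- The subvector `x_i` of `x`. -/
def blk {N n : ℕ} (b : Fin N → Fin n) (i : Fin n) (x : EuclideanSpace ℝ (Fin N)) : Block b i :=
  WithLp.toLp 2 fun j => x j.1

/-- The diagonal block `M_ii` of a matrix. -/
def diagBlk {N n : ℕ} (b : Fin N → Fin n) (i : Fin n) (M : Matrix (Fin N) (Fin N) ℝ) :
    Matrix {j : Fin N // b j = i} {j : Fin N // b j = i} ℝ :=
  M.submatrix Subtype.val Subtype.val

/-- The block diagonal matrix `Diag(M_11, …, M_nn)`. -/
def blkDiag {N n : ℕ} (b : Fin N → Fin n) (M : Matrix (Fin N) (Fin N) ℝ) :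
    Matrix (Fin N) (Fin N) ℝ :=
  Matrix.of fun j k => if b j = b k then M j k else 0

/-- The vector `x` with `d` added to its `i`-th subvector. -/
def addBlk {N n : ℕ} (b : Fin N → Fin n) (i : Fin n) (x : EuclideanSpace ℝ (Fin N))
    (d : Block b i) : EuclideanSpace ℝ (Fin N) :=
  WithLp.toLp 2 fun j => if hj : b j = i then x j + d ⟨j, hj⟩ else x j

/-- The block separable function `g(x) = ∑ i, g_i(x_i)`. -/
def gSum {N n : ℕ} (b : Fin N → Fin n) (g : (i : Fin n) → Block b i → EReal)
    (x : EuclideanSpace ℝ (Fin N)) : EReal :=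
  ∑ i, g i (blk b i x)

/-- The objective function `F = f + g`. -/
def objective {N n : ℕ} (b : Fin N → Fin n) (f : EuclideanSpace ℝ (Fin N) → EReal)
    (g : (i : Fin n) → Block b i → EReal) (x : EuclideanSpace ℝ (Fin N)) : EReal :=
  f x + gSum b g x

/-- The sublevel set `{x | F(x) ≤ F(x⁰)}`. -/
def sublevel {V : Type*} (F : V → EReal) (x0 : V) : Set V := {x | F x ≤ F x0}

/-- Standing assumptions on the problem `min F = f + g`.  (Continuity of the Hessian of `f` is
part of self-concordance.) -/
structure IsCompositeSCProblem {N n : ℕ} (b : Fin N → Fin n)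
    (f : EuclideanSpace ℝ (Fin N) → EReal) (g : (i : Fin n) → Block b i → EReal) : Prop where
  selfConcordant : IsSelfConcordant 2 f
  properClosedConvex : ∀ i, IsProperClosedConvex (g i)
  posDef : ∀ x ∈ dom (objective b f g), (hessian (re f) x).PosDef
  existsUnique_min : ∃! x, ∀ y, objective b f g x ≤ objective b f g y

/-! ### The method -/

/-- `d` is an admissible inexact solution, with accuracy `η`, of the `i`-th block subproblem
`min_d f(x) + ⟨∇_i f(x), d⟩ + ½ ⟨d, ∇²_ii f(x) d⟩ + g_i(x_i + d)`. -/
def IsInexactDirection {N n : ℕ} (b : Fin N → Fin n) (f : EuclideanSpace ℝ (Fin N) → EReal)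
    (g : (i : Fin n) → Block b i → EReal) (η : ℝ) (x : EuclideanSpace ℝ (Fin N)) (i : Fin n)
    (d : Block b i) : Prop :=
  ∃ v : Block b i,
    (∃ s ∈ subdiff (g i) (blk b i x + d),
      -v = blk b i (gradient (re f) x)
        + Matrix.toEuclideanLin (diagBlk b i (hessian (re f) x)) d + s) ∧
    weightedNorm (diagBlk b i (hessian (re f) x))⁻¹ v ≤
      η * weightedNorm (diagBlk b i (hessian (re f) x)) d

/-- One step of the method from `x` to `x'`, once the block `i` has been picked. -/
def IsStep {N n : ℕ} (b : Fin N → Fin n) (f : EuclideanSpace ℝ (Fin N) → EReal)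
    (g : (i : Fin n) → Block b i → EReal) (η : ℝ) (x : EuclideanSpace ℝ (Fin N)) (i : Fin n)
    (x' : EuclideanSpace ℝ (Fin N)) : Prop :=
  ∃ d : Block b i, IsInexactDirection b f g η x i d ∧
    x' = addBlk b i x ((1 + weightedNorm (diagBlk b i (hessian (re f) x)) d)⁻¹ • d)

/-- The random sequence `x` is generated by the randomized block proximal damped Newton method
started at `x0`, where the blocks `idx k` are picked independently with probabilities `p`, and
the inexact solution used at step `k` may depend on the blocks picked up to then (only). -/
structure IsGenerated {Ω : Type*} [MeasurableSpace Ω] (P : Measure Ω) {N n : ℕ}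
    (b : Fin N → Fin n) (f : EuclideanSpace ℝ (Fin N) → EReal)
    (g : (i : Fin n) → Block b i → EReal) (η : ℝ) (p : Fin n → ℝ)
    (x0 : EuclideanSpace ℝ (Fin N)) (idx : ℕ → Ω → Fin n)
    (x : ℕ → Ω → EuclideanSpace ℝ (Fin N)) : Prop where
  measurable_idx : ∀ k, Measurable (idx k)
  indep : iIndepFun idx P
  law : ∀ k i, P.real (idx k ⁻¹' {i}) = p i
  init : ∀ ω, x 0 ω = x0
  step : ∀ k ω, IsStep b f g η (x k ω) (idx k ω) (x (k + 1) ω)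
  adapted : ∀ k ω ω', (∀ j < k, idx j ω = idx j ω') → x k ω = x k ω'

/-! ### Constants -/

/-- `σ_f`, the minimum of `λ_min(∇²f(x))` over `x ∈ S`. -/
def sigmaF {N : ℕ} (f : EuclideanSpace ℝ (Fin N) → EReal) (S : Set (EuclideanSpace ℝ (Fin N))) :
    ℝ :=
  sInf ((fun x => lambdaMin (hessian (re f) x)) '' S)

/-- `L_f`, the maximum of `‖∇²f(x)‖` over `x ∈ S`. -/
def LF {N : ℕ} (f : EuclideanSpace ℝ (Fin N) → EReal) (S : Set (EuclideanSpace ℝ (Fin N))) : ℝ :=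
  sSup ((fun x => spectralNorm (hessian (re f) x)) '' S)

/-- The constant `c₁`:
`(1-η) / (√n max_{x ∈ S} {(1+η) ‖H(x)^½ (∇²f(x))^(-½)‖ + ‖H(x)^(-½) (∇²f(x))^½‖})`,
where `H(x)` is the block diagonal part of `∇²f(x)`. -/
def c1 {N n : ℕ} (b : Fin N → Fin n) (f : EuclideanSpace ℝ (Fin N) → EReal) (η : ℝ)
    (S : Set (EuclideanSpace ℝ (Fin N))) : ℝ :=
  (1 - η) / (Real.sqrt n * sSup ((fun x =>
    (1 + η) * spectralNorm
        (CFC.sqrt (blkDiag b (hessian (re f) x)) * (CFC.sqrt (hessian (re f) x))⁻¹)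
      + spectralNorm
        ((CFC.sqrt (blkDiag b (hessian (re f) x)))⁻¹ * CFC.sqrt (hessian (re f) x))) '' S))

/-- The function `ω_*(t) = -t - ln(1 - t)`. -/
def omegaStar (t : ℝ) : ℝ := -t - Real.log (1 - t)

/-- The inverse of `ω_*` restricted to `[0, 1)`. -/
def omegaStarInv : ℝ → ℝ := Function.invFunOn omegaStar (Set.Ico 0 1)

/-- The contraction factor `1 - c² p² (1 - ω_*⁻¹(δ)) / (2 (1 + c p ω_*⁻¹(δ)))`. -/
def rate (c p δ : ℝ) : ℝ :=
  1 - c ^ 2 * p ^ 2 * (1 - omegaStarInv δ) / (2 * (1 + c * p * omegaStarInv δ))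

end RBPDN

end

noncomputable section

namespace RBPDN

/-! ### One-dimensional estimates -/

/-! Write λ_i for the local norm of the direction d_i that would be taken from x if block i were
picked, and Λ = (∑ λ_i²)^(1/2). Let δ = F(x) - F*, ω(t) = t - ln(1+t), and let ω_* be its conjugate.
Everything rests on two bounds in terms of Λ.

Progress. The upper bound ω_* for self-concordant functions, convexity of g_i and the inexact
optimality condition give a decrease of at least λ_i²/(4(1+λ_i)) for block i (`step_decrease`).
Averaging over i with weights p_i and using convexity of t²/(1+t), the expected decrease is at least
u²/(4(1+u)) with u = p_min Λ (`sum_mul_sq_div_ge`).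

Gap. The lower bound ω for f between x and the minimizer, at local distance r, and the subgradient
inequalities for the g_i reduce δ to three terms: a linearization error of g over the d_i, the term
(1+η)Λar coming from the stacked optimality conditions, and -ω(r) (`gap_le`). The error is at most
(L_f+L_g)∑‖d_i‖² ≤ KΛ² with K = (L_f+L_g)/σ_f. The delicate case is when x + d_i leaves S, where ∇g
is not controlled: there F must be nondecreasing at the exit point, and the gradient of f takes over
(`linearization_error_le`). Fenchel-Young removes r, leaving KΛ² + ω_*((1+η)aΛ). With M the maximum
occurring in c₁, the second spectral norm in M pays for KΛ², so δ ≤ ω_*(KMΛ) as long as KMΛ < 1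
(`gap_le_omegaStar`). Since c̃₄ = 1/(KM), always c̃₄ ω_*⁻¹(δ) ≤ Λ.

Inserting this into the progress bound and using ω_*(w) ≤ w²/(2(1-w)) gives the contraction by q
(`decrease_ge`, `expected_decrease`). Steps never increase F, so the iterates stay in S, which is
compact because the minimizer is unique (`isCompact_sublevel`); hence the extrema over S used here
are finite, and σ_f is positive. Finally, x^k is a function of finitely many picks, so expectations
are finite sums and the one-step bound iterates (`IsGenerated.integral_le`). -/

lemma le_of_hasDerivAt_nonneg {A A1 : ℝ → ℝ} {T : ℝ} (hT : 0 ≤ T)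
    (h : ∀ t ∈ Icc 0 T, HasDerivAt A (A1 t) t) (h1 : ∀ t ∈ Icc 0 T, 0 ≤ A1 t) : A 0 ≤ A T := by
  have hm : MonotoneOn A (Icc 0 T) := by
    apply monotoneOn_of_deriv_nonneg (convex_Icc 0 T)
    · exact fun t ht => (h t ht).continuousAt.continuousWithinAt
    · intro t ht
      rw [interior_Icc] at ht
      exact (h t (Ioo_subset_Icc_self ht)).differentiableAt.differentiableWithinAt
    · intro t ht
      rw [interior_Icc] at ht
      rw [(h t (Ioo_subset_Icc_self ht)).deriv]
      exact h1 t (Ioo_subset_Icc_self ht)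
  exact hm (left_mem_Icc.2 hT) (right_mem_Icc.2 hT) hT

/-- Comparison principle behind both self-concordance bounds: it is applied to the difference of a
function and an explicit model with the same value and slope at 0. -/
lemma le_of_hasDerivAt_two_nonneg {A A1 A2 : ℝ → ℝ} {T : ℝ} (hT : 0 ≤ T)
    (h : ∀ t ∈ Icc 0 T, HasDerivAt A (A1 t) t) (h1 : ∀ t ∈ Icc 0 T, HasDerivAt A1 (A2 t) t)
    (h0 : 0 ≤ A1 0) (h2 : ∀ t ∈ Icc 0 T, 0 ≤ A2 t) : A 0 ≤ A T := by
  refine le_of_hasDerivAt_nonneg hT h fun t ht => h0.trans ?_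
  exact le_of_hasDerivAt_nonneg ht.1 (fun s hs => h1 s ⟨hs.1, hs.2.trans ht.2⟩)
    fun s hs => h2 s ⟨hs.1, hs.2.trans ht.2⟩

/-- The data of a one-dimensional self-concordant function on `[0, T]` with positive second
derivative. -/
structure IsSCLine (T : ℝ) (ψ ψ1 φ : ℝ → ℝ) : Prop where
  d1 : ∀ t ∈ Icc 0 T, HasDerivAt ψ (ψ1 t) t
  d2 : ∀ t ∈ Icc 0 T, HasDerivAt ψ1 (φ t) t
  d3 : ∀ t ∈ Icc 0 T, ∃ c, HasDerivAt φ c t ∧ |c| ≤ 2 * φ t ^ (3 / 2 : ℝ)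
  pos : ∀ t ∈ Icc 0 T, 0 < φ t

/-- The derivative of φ^(-1/2) is -φ' φ^(-3/2) / 2, so self-concordance with constant 2 says exactly
that φ^(-1/2) is 1-Lipschitz. Positivity of φ is what makes this legitimate. -/
lemma IsSCLine.abs_inv_sqrt_sub {T : ℝ} {ψ ψ1 φ : ℝ → ℝ} (h : IsSCLine T ψ ψ1 φ) {t : ℝ}
    (ht : t ∈ Icc 0 T) : |φ t ^ (-(1 / 2) : ℝ) - φ 0 ^ (-(1 / 2) : ℝ)| ≤ t := by
  have h0 : (0 : ℝ) ∈ Icc 0 T := ⟨le_rfl, ht.1.trans ht.2⟩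
  choose! c hc hc2 using h.d3
  have key : ∀ s ∈ Icc 0 T, HasDerivWithinAt (fun s => φ s ^ (-(1 / 2) : ℝ))
      (c s * (-(1 / 2)) * φ s ^ (-(1 / 2) - 1 : ℝ)) (Icc 0 T) s := fun s hs =>
    ((hc s hs).rpow_const (Or.inl (h.pos s hs).ne')).hasDerivWithinAt
  have bd : ∀ s ∈ Icc 0 T, ‖c s * (-(1 / 2)) * φ s ^ (-(1 / 2) - 1 : ℝ)‖ ≤ 1 := by
    intro s hs
    have hp := h.pos s hs
    rw [Real.norm_eq_abs, abs_mul, abs_mul, abs_of_nonneg (Real.rpow_nonneg hp.le _)]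
    have e : φ s ^ (3 / 2 : ℝ) * φ s ^ (-(1 / 2) - 1 : ℝ) = 1 := by
      rw [← Real.rpow_add hp]; norm_num
    have h12 : |(-(1 / 2) : ℝ)| = 1 / 2 := by norm_num
    rw [h12]
    calc |c s| * (1 / 2) * φ s ^ (-(1 / 2) - 1 : ℝ)
        ≤ (2 * φ s ^ (3 / 2 : ℝ)) * (1 / 2) * φ s ^ (-(1 / 2) - 1 : ℝ) := by
          gcongr; exact hc2 s hs
      _ = φ s ^ (3 / 2 : ℝ) * φ s ^ (-(1 / 2) - 1 : ℝ) := by ring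
      _ = 1 := e
  have := (convex_Icc (0 : ℝ) T).norm_image_sub_le_of_norm_hasDerivWithin_le key bd h0 ht
  simpa [Real.norm_eq_abs, abs_of_nonneg ht.1] using this

lemma rpow_neg_half {y : ℝ} (hy : 0 < y) : y ^ (-(1 / 2) : ℝ) = (Real.sqrt y)⁻¹ := by
  rw [Real.rpow_neg hy.le, Real.sqrt_eq_rpow]

lemma IsSCLine.second_le {T : ℝ} {ψ ψ1 φ : ℝ → ℝ} (h : IsSCLine T ψ ψ1 φ) {t : ℝ}
    (ht : t ∈ Icc 0 T) (hlt : Real.sqrt (φ 0) * t < 1) :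
    φ t ≤ (Real.sqrt (φ 0) / (1 - Real.sqrt (φ 0) * t)) ^ 2 := by
  have h0 : (0 : ℝ) ∈ Icc 0 T := ⟨le_rfl, ht.1.trans ht.2⟩
  have hρ : 0 < Real.sqrt (φ 0) := Real.sqrt_pos.2 (h.pos 0 h0)
  have hτ : 0 < Real.sqrt (φ t) := Real.sqrt_pos.2 (h.pos t ht)
  have := (abs_le.1 (h.abs_inv_sqrt_sub ht)).1
  rw [rpow_neg_half (h.pos t ht), rpow_neg_half (h.pos 0 h0)] at this
  have h1 : 0 < 1 - Real.sqrt (φ 0) * t := by linarith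
  rw [← Real.sqrt_le_left (by positivity)]
  have h2 : (1 - Real.sqrt (φ 0) * t) / Real.sqrt (φ 0) ≤ (Real.sqrt (φ t))⁻¹ := by
    have : (1 - Real.sqrt (φ 0) * t) / Real.sqrt (φ 0) = (Real.sqrt (φ 0))⁻¹ - t := by
      field_simp
    linarith
  have h3 := inv_anti₀ (by positivity) h2
  rwa [inv_inv, inv_div] at h3

lemma IsSCLine.le_second {T : ℝ} {ψ ψ1 φ : ℝ → ℝ} (h : IsSCLine T ψ ψ1 φ) {t : ℝ}
    (ht : t ∈ Icc 0 T) : (Real.sqrt (φ 0) / (1 + Real.sqrt (φ 0) * t)) ^ 2 ≤ φ t := by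
  have h0 : (0 : ℝ) ∈ Icc 0 T := ⟨le_rfl, ht.1.trans ht.2⟩
  have hρ : 0 < Real.sqrt (φ 0) := Real.sqrt_pos.2 (h.pos 0 h0)
  have hτ : 0 < Real.sqrt (φ t) := Real.sqrt_pos.2 (h.pos t ht)
  have := (abs_le.1 (h.abs_inv_sqrt_sub ht)).2
  rw [rpow_neg_half (h.pos t ht), rpow_neg_half (h.pos 0 h0)] at this
  have h1 : 0 < 1 + Real.sqrt (φ 0) * t := by have := ht.1; positivity
  rw [← Real.le_sqrt' (by positivity)]
  have h2 : (Real.sqrt (φ t))⁻¹ ≤ (1 + Real.sqrt (φ 0) * t) / Real.sqrt (φ 0) := by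
    have : (1 + Real.sqrt (φ 0) * t) / Real.sqrt (φ 0) = (Real.sqrt (φ 0))⁻¹ + t := by
      field_simp
    linarith
  have h3 := inv_anti₀ (by positivity) h2
  rwa [inv_inv, inv_div] at h3

/-- The model -ρt - ln(1 - ρt) has second derivative (ρ/(1 - ρt))², the bound of `second_le`; two
integrations give the claim. -/
lemma IsSCLine.upper {T : ℝ} (hT : 0 ≤ T) {ψ ψ1 φ : ℝ → ℝ} (h : IsSCLine T ψ ψ1 φ)
    (hlt : Real.sqrt (φ 0) * T < 1) :
    ψ T ≤ ψ 0 + T * ψ1 0 + omegaStar (Real.sqrt (φ 0) * T) := by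
  set ρ := Real.sqrt (φ 0) with hρ
  have hρ0 : 0 ≤ ρ := Real.sqrt_nonneg _
  have hpos : ∀ t ∈ Icc 0 T, 0 < 1 - ρ * t := fun t ht => by
    have := mul_le_mul_of_nonneg_left ht.2 hρ0
    linarith
  have key := le_of_hasDerivAt_two_nonneg hT
    (A := fun t => (t * ψ1 0 + (-(ρ * t) - Real.log (1 - ρ * t))) - ψ t)
    (A1 := fun t => (ψ1 0 + (-ρ + ρ / (1 - ρ * t))) - ψ1 t)
    (A2 := fun t => (ρ / (1 - ρ * t)) ^ 2 - φ t) ?_ ?_ ?_ ?_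
  · simp [omegaStar] at key ⊢
    linarith
  · intro t ht
    have hl : HasDerivAt (fun t => 1 - ρ * t) (-ρ) t := by
      simpa using ((hasDerivAt_id t).const_mul ρ).const_sub 1
    have h1 := (hl.log (hpos t ht).ne')
    have h2 : HasDerivAt (fun t => -(ρ * t)) (-ρ) t := by
      exact ((hasDerivAt_id t).const_mul ρ).neg.congr_deriv (by simp)
    have h3 : HasDerivAt (fun t => t * ψ1 0) (ψ1 0) t := by
      simpa using (hasDerivAt_id t).mul_const (ψ1 0)
    exact ((h3.add (h2.sub h1)).sub (h.d1 t ht)).congr_deriv (by ring)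
  · intro t ht
    have hl : HasDerivAt (fun t => 1 - ρ * t) (-ρ) t := by
      simpa using ((hasDerivAt_id t).const_mul ρ).const_sub 1
    have h1 := (((hasDerivAt_const t ρ).div hl (hpos t ht).ne').const_add (-ρ)).const_add (ψ1 0)
    exact (h1.sub (h.d2 t ht)).congr_deriv (by rw [div_pow]; ring)
  · simp
  · intro t ht
    have := h.second_le ht (by have := hpos t ht; linarith)
    linarith

/-- Same comparison with the model ρt - ln(1 + ρt), which is defined for every t ≥ 0, so no
restriction on the length is needed. -/
lemma IsSCLine.lower {T : ℝ} (hT : 0 ≤ T) {ψ ψ1 φ : ℝ → ℝ} (h : IsSCLine T ψ ψ1 φ) :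
    ψ 0 + T * ψ1 0 + (Real.sqrt (φ 0) * T - Real.log (1 + Real.sqrt (φ 0) * T)) ≤ ψ T := by
  set ρ := Real.sqrt (φ 0) with hρ
  have hρ0 : 0 ≤ ρ := Real.sqrt_nonneg _
  have hpos : ∀ t ∈ Icc 0 T, 0 < 1 + ρ * t := fun t ht => by
    have := ht.1
    positivity
  have key := le_of_hasDerivAt_two_nonneg hT
    (A := fun t => ψ t - (t * ψ1 0 + ((ρ * t) - Real.log (1 + ρ * t))))
    (A1 := fun t => ψ1 t - (ψ1 0 + (ρ - ρ / (1 + ρ * t))))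
    (A2 := fun t => φ t - (ρ / (1 + ρ * t)) ^ 2) ?_ ?_ ?_ ?_
  · simp at key ⊢
    linarith
  · intro t ht
    have hl : HasDerivAt (fun t => 1 + ρ * t) ρ t := by
      simpa using ((hasDerivAt_id t).const_mul ρ).const_add 1
    have h1 := (hl.log (hpos t ht).ne')
    have h2 : HasDerivAt (fun t => (ρ * t)) ρ t := by
      simpa using ((hasDerivAt_id t).const_mul ρ)
    have h3 : HasDerivAt (fun t => t * ψ1 0) (ψ1 0) t := by
      simpa using (hasDerivAt_id t).mul_const (ψ1 0)
    exact (h.d1 t ht).sub (h3.add (h2.sub h1))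
  · intro t ht
    have hl : HasDerivAt (fun t => 1 + ρ * t) ρ t := by
      simpa using ((hasDerivAt_id t).const_mul ρ).const_add 1
    have h1 := (((hasDerivAt_const t ρ).div hl (hpos t ht).ne').const_sub ρ).const_add (ψ1 0)
    exact ((h.d2 t ht).sub h1).congr_deriv (by rw [div_pow]; ring)
  · simp
  · intro t ht
    have := h.le_second ht
    linarith

/-! ### The functions `ω` and `ω_*` -/

lemma log_one_add_le {l : ℝ} (hl : 0 ≤ l) : Real.log (1 + l) ≤ l - l ^ 2 / (2 * (1 + l)) := by
  have key := le_of_hasDerivAt_nonneg hl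
    (A := fun t => (t - t ^ 2 / (2 * (1 + t))) - Real.log (1 + t))
    (A1 := fun t => t ^ 2 / (2 * (1 + t) ^ 2)) ?_ ?_
  · simp at key ⊢
    linarith
  · intro t ht
    have hp : 0 < 1 + t := by linarith [ht.1]
    have hl : HasDerivAt (fun t : ℝ => 1 + t) 1 t := (hasDerivAt_id t).const_add 1
    have h1 := ((hasDerivAt_id t).sub ((hasDerivAt_pow 2 t).div (hl.const_mul 2)
      (by positivity))).sub (hl.log hp.ne')
    refine h1.congr_deriv ?_
    simp
    field_simp
    ring
  · intro t _
    positivity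

lemma hasDerivAt_omegaStar {t : ℝ} (ht : t < 1) : HasDerivAt omegaStar (t / (1 - t)) t := by
  have hp : 0 < 1 - t := by linarith
  have hl : HasDerivAt (fun t : ℝ => 1 - t) (-1) t := by
    simpa using (hasDerivAt_id t).const_sub 1
  refine ((hasDerivAt_id t).neg.sub (hl.log hp.ne')).congr_deriv ?_
  field_simp
  ring

lemma omegaStar_zero : omegaStar 0 = 0 := by simp [omegaStar]

/-- Since ω_*'(t) = t/(1-t) ≥ t, the function ω_*(t) - t²/2 is nondecreasing. This quadratic growth
later absorbs the linearization error of g. -/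
lemma omegaStar_sub_sq_le {a b : ℝ} (ha : 0 ≤ a) (hab : a ≤ b) (hb : b < 1) :
    omegaStar a + (b ^ 2 - a ^ 2) / 2 ≤ omegaStar b := by
  have key := le_of_hasDerivAt_nonneg (sub_nonneg.2 hab)
    (A := fun t => omegaStar (a + t) - (a + t) ^ 2 / 2)
    (A1 := fun t => (a + t) / (1 - (a + t)) - (a + t)) ?_ ?_
  · simp at key ⊢
    linarith
  · intro t ht
    have h1 : a + t < 1 := by linarith [ht.2]
    have hl : HasDerivAt (fun t : ℝ => a + t) 1 t := (hasDerivAt_id t).const_add a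
    have := ((hasDerivAt_omegaStar h1).comp t hl).sub ((hl.pow 2).div_const 2)
    exact this.congr_deriv (by simp)
  · intro t ht
    have h1 : 0 < 1 - (a + t) := by linarith [ht.2]
    have h2 : 0 ≤ a + t := by linarith [ht.1]
    rw [sub_nonneg, le_div_iff₀ h1]
    nlinarith

lemma omegaStar_strictMonoOn : StrictMonoOn omegaStar (Ico 0 1) := by
  intro a ha b hb hab
  have := omegaStar_sub_sq_le ha.1 hab.le hb.2
  have h2 : 0 < (b ^ 2 - a ^ 2) / 2 := by nlinarith [ha.1]
  linarith

lemma omegaStar_le {w : ℝ} (hw : w ∈ Ico (0 : ℝ) 1) : omegaStar w ≤ w ^ 2 / (2 * (1 - w)) := by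
  have key := le_of_hasDerivAt_nonneg hw.1
    (A := fun t => t ^ 2 / (2 * (1 - t)) - omegaStar t)
    (A1 := fun t => t ^ 2 / (2 * (1 - t) ^ 2)) ?_ ?_
  · simp [omegaStar_zero] at key ⊢
    linarith
  · intro t ht
    have h1 : t < 1 := by linarith [ht.2, hw.2]
    have hp : 0 < 1 - t := by linarith
    have hl : HasDerivAt (fun t : ℝ => 1 - t) (-1) t := by
      simpa using (hasDerivAt_id t).const_sub 1
    refine (((hasDerivAt_pow 2 t).div (hl.const_mul 2) (by positivity)).sub
      (hasDerivAt_omegaStar h1)).congr_deriv ?_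
    field_simp
    ring
  · intro t _
    positivity

/-- Fenchel-Young for the pair ω, ω_*. It is ln s ≤ s - 1 at s = (1+r)(1-α). -/
lemma mul_le_omega_add_omegaStar {α r : ℝ} (hα : α < 1) (hr : 0 ≤ r) :
    α * r ≤ (r - Real.log (1 + r)) + omegaStar α := by
  have h1 : 0 < 1 + r := by linarith
  have h2 : 0 < 1 - α := by linarith
  have := Real.log_le_sub_one_of_pos (mul_pos h1 h2)
  rw [Real.log_mul h1.ne' h2.ne'] at this
  unfold omegaStar
  nlinarith

lemma exists_omegaStar_eq {δ : ℝ} (hδ : 0 ≤ δ) : ∃ w ∈ Ico (0 : ℝ) 1, omegaStar w = δ := by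
  -- Chosen so that -ln(1 - B) = δ + 1; then ω_*(B) = δ + 1 - B > δ and the intermediate value
  -- theorem applies on [0, B].
  set B : ℝ := 1 - Real.exp (-(δ + 1)) with hB
  have hB1 : B < 1 := by simp [hB, Real.exp_pos]
  have hB0 : 0 ≤ B := by simp [hB]; linarith
  have hc : ContinuousOn omegaStar (Icc 0 B) := fun t ht =>
    (hasDerivAt_omegaStar (lt_of_le_of_lt ht.2 hB1)).continuousAt.continuousWithinAt
  have hmem : δ ∈ Icc (omegaStar 0) (omegaStar B) := by
    refine ⟨by rwa [omegaStar_zero], ?_⟩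
    have : omegaStar B = -B + (δ + 1) := by simp [omegaStar, hB]; ring
    linarith
  obtain ⟨w, hw, hwe⟩ := intermediate_value_Icc hB0 hc hmem
  exact ⟨w, ⟨hw.1, lt_of_le_of_lt hw.2 hB1⟩, hwe⟩

lemma omegaStarInv_mem {δ : ℝ} (hδ : 0 ≤ δ) : omegaStarInv δ ∈ Ico (0 : ℝ) 1 :=
  Function.invFunOn_mem (exists_omegaStar_eq hδ)

lemma omegaStar_omegaStarInv {δ : ℝ} (hδ : 0 ≤ δ) : omegaStar (omegaStarInv δ) = δ :=
  Function.invFunOn_eq (exists_omegaStar_eq hδ)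

lemma omegaStarInv_mono {δ δ' : ℝ} (hδ : 0 ≤ δ) (h : δ ≤ δ') :
    omegaStarInv δ ≤ omegaStarInv δ' := by
  rw [← omegaStar_strictMonoOn.le_iff_le (omegaStarInv_mem hδ) (omegaStarInv_mem (hδ.trans h)),
    omegaStar_omegaStarInv hδ, omegaStar_omegaStarInv (hδ.trans h)]
  exact h

/-- The comparison of a gap with `ω_*` of the scaled step length. -/
lemma gap_le_omegaStar {δ K Λ η a a' r M : ℝ} (hK : 1 ≤ K) (hΛ : 0 ≤ Λ) (hη : 0 ≤ η) (ha : 0 ≤ a)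
    (ha' : 0 ≤ a') (haa : 1 ≤ a * a') (hM : (1 + η) * a + a' ≤ M) (hr : 0 ≤ r)
    (hδ : δ ≤ K * Λ ^ 2 + (1 + η) * Λ * a * r - (r - Real.log (1 + r))) (hT : K * M * Λ < 1) :
    δ ≤ omegaStar (K * M * Λ) := by
  set α := (1 + η) * Λ * a with hα
  have hα0 : 0 ≤ α := by positivity
  have hle : K * ((1 + η) * a + a') * Λ ≤ K * M * Λ := by gcongr
  have hααT : α + K * a' * Λ ≤ K * M * Λ := by
    have : α ≤ K * α := le_mul_of_one_le_left hα0 hK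
    nlinarith
  have hβ : 0 ≤ K * a' * Λ := by positivity
  have hαT : α ≤ K * M * Λ := by linarith
  -- Fenchel-Young eliminates r; it remains to fit KΛ² between ω_*(α) and ω_*(KMΛ). The quadratic
  -- growth of ω_* gives at least the cross term α·Ka'Λ, which is at least KΛ² because aa' ≥ 1.
  have h1 := mul_le_omega_add_omegaStar (lt_of_le_of_lt hαT hT) hr
  have h2 := omegaStar_sub_sq_le hα0 hαT hT
  have h3 : (α + K * a' * Λ) ^ 2 ≤ (K * M * Λ) ^ 2 := by gcongr
  have h4 : K * Λ ^ 2 ≤ α * (K * a' * Λ) := by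
    have e : α * (K * a' * Λ) = K * Λ ^ 2 * ((1 + η) * (a * a')) := by rw [hα]; ring
    rw [e]
    refine le_mul_of_one_le_right (by positivity) ?_
    nlinarith
  nlinarith

/-- The one-step contraction. -/
lemma decrease_ge {c P δ δ0 Λ : ℝ} (hc : 0 < c) (hP : 0 < P) (hδ : 0 ≤ δ) (hδ0 : δ ≤ δ0)
    (hΛ : c * omegaStarInv δ ≤ Λ) :
    (1 - rate c P δ0) * δ ≤ (P * Λ) ^ 2 / (4 * (1 + P * Λ)) := by
  set w := omegaStarInv δ with hw
  set w0 := omegaStarInv δ0 with hw0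
  have hwm := omegaStarInv_mem hδ
  rw [← hw] at hwm
  have hw0m := omegaStarInv_mem (hδ.trans hδ0)
  rw [← hw0] at hw0m
  have hww : w ≤ w0 := omegaStarInv_mono hδ hδ0
  have hδw : δ ≤ w ^ 2 / (2 * (1 - w)) := by
    have := omegaStar_le hwm
    rwa [omegaStar_omegaStarInv hδ] at this
  have h1w : 0 < 1 - w := by linarith [hwm.2]
  have h1w0 : 0 < 1 - w0 := by linarith [hw0m.2]
  have hwn := hwm.1
  have hw0n := hw0m.1
  have hcp : 0 < c * P := by positivity
  -- The factor (1-w)/(1+cPw) decreases in w, so the value at the initial gap is the worst one and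
  -- serves all iterates.
  have s1 : (1 - rate c P δ0) * δ ≤ (c * P) ^ 2 * (1 - w) / (2 * (1 + c * P * w)) * δ := by
    have e : 1 - rate c P δ0 = (c * P) ^ 2 * (1 - w0) / (2 * (1 + c * P * w0)) := by
      simp only [rate, ← hw0]; ring
    rw [e]
    gcongr
  -- The bound δ ≤ w²/(2(1-w)) cancels the factor 1-w.
  have s2 : (c * P) ^ 2 * (1 - w) / (2 * (1 + c * P * w)) * δ
      ≤ (P * (c * w)) ^ 2 / (4 * (1 + P * (c * w))) := by
    calc _ ≤ (c * P) ^ 2 * (1 - w) / (2 * (1 + c * P * w)) * (w ^ 2 / (2 * (1 - w))) := by gcongr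
      _ = _ := by
        have : 0 < 1 + c * P * w := by positivity
        have : 0 < 1 + P * (c * w) := by positivity
        field_simp
        ring
  have s3 : (P * (c * w)) ^ 2 / (4 * (1 + P * (c * w))) ≤ (P * Λ) ^ 2 / (4 * (1 + P * Λ)) := by
    have hu : 0 ≤ P * (c * w) := by positivity
    have hle : P * (c * w) ≤ P * Λ := by gcongr
    generalize P * (c * w) = u at *
    generalize P * Λ = z at *
    have hz : 0 ≤ z := hu.trans hle
    rw [div_le_div_iff₀ (by positivity) (by positivity)]
    nlinarith [mul_nonneg hu hz, mul_nonneg (mul_nonneg hu hz) (sub_nonneg.2 hle)]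
  exact s1.trans (s2.trans s3)

lemma rate_mem_Ioo {c P δ : ℝ} (hc : 0 < c) (hc1 : c ≤ 1) (hP : 0 < P) (hP1 : P ≤ 1)
    (hδ : 0 ≤ δ) : rate c P δ ∈ Ioo (0 : ℝ) 1 := by
  have hw := omegaStarInv_mem hδ
  set w := omegaStarInv δ with hwd
  have h1 : 0 < 1 - w := by linarith [hw.2]
  have hw0 := hw.1
  simp only [rate, ← hwd]
  have hcp1 : c ^ 2 * P ^ 2 ≤ 1 := by
    rw [← mul_pow]
    exact pow_le_one₀ (by positivity) (mul_le_one₀ hc1 hP.le hP1)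
  constructor
  · rw [sub_pos, div_lt_one (by positivity)]
    have : 0 ≤ c * P * w := by positivity
    nlinarith
  · rw [sub_lt_self_iff]
    positivity

/-- Weighted averages of `t² / (1 + t)`. -/
lemma sum_mul_sq_div_ge {ι : Type*} [Fintype ι] {p l : ι → ℝ} (hp : ∀ i, 0 < p i)
    (hps : ∑ i, p i = 1) (hl : ∀ i, 0 ≤ l i) {P : ℝ} (hP : 0 < P) (hPp : ∀ i, P ≤ p i) :
    (P * Real.sqrt (∑ i, l i ^ 2)) ^ 2 / (1 + P * Real.sqrt (∑ i, l i ^ 2))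
      ≤ ∑ i, p i * (l i ^ 2 / (1 + l i)) := by
  set Λ := Real.sqrt (∑ i, l i ^ 2) with hΛ
  have hΛ0 : 0 ≤ Λ := Real.sqrt_nonneg _
  set m := ∑ i, p i * l i with hm
  have hm1 : P * Λ ≤ m := by
    have : Λ ≤ ∑ i, l i := by
      rw [hΛ]
      apply Real.sqrt_le_iff.2 ⟨Finset.sum_nonneg fun i _ => hl i, ?_⟩
      exact Finset.sum_sq_le_sq_sum_of_nonneg fun i _ => hl i
    calc P * Λ ≤ P * ∑ i, l i := by gcongr
      _ = ∑ i, P * l i := Finset.mul_sum _ _ _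
      _ ≤ m := Finset.sum_le_sum fun i _ => mul_le_mul_of_nonneg_right (hPp i) (hl i)
  have hm0 : 0 ≤ m := (by positivity : 0 ≤ P * Λ).trans hm1
  -- Jensen's inequality by hand: the left side is the tangent at the mean m of the convex function
  -- t²/(1+t) = t - 1 + 1/(1+t), and the difference is an explicit square.
  have tangent : ∀ t : ℝ, 0 ≤ t → m - 1 + 1 / (1 + m) + (1 - 1 / (1 + m) ^ 2) * (t - m)
      ≤ t ^ 2 / (1 + t) := by
    intro t ht
    have e : t ^ 2 / (1 + t) - (m - 1 + 1 / (1 + m) + (1 - 1 / (1 + m) ^ 2) * (t - m))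
        = (t - m) ^ 2 / ((1 + t) * (1 + m) ^ 2) := by
      field_simp
      ring
    have : 0 ≤ (t - m) ^ 2 / ((1 + t) * (1 + m) ^ 2) := by positivity
    linarith
  have h1 : m ^ 2 / (1 + m) ≤ ∑ i, p i * (l i ^ 2 / (1 + l i)) := by
    calc m ^ 2 / (1 + m) = m - 1 + 1 / (1 + m) := by field_simp; ring
      _ = ∑ i, p i * (m - 1 + 1 / (1 + m) + (1 - 1 / (1 + m) ^ 2) * (l i - m)) := by
        simp only [mul_add, mul_sub, Finset.sum_add_distrib, Finset.sum_sub_distrib,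
          ← Finset.sum_mul, hps, one_mul]
        have : ∑ i, p i * ((1 - 1 / (1 + m) ^ 2) * l i) = (1 - 1 / (1 + m) ^ 2) * m := by
          rw [hm, Finset.mul_sum]
          exact Finset.sum_congr rfl fun i _ => by ring
        rw [this]
        ring
      _ ≤ _ := Finset.sum_le_sum fun i _ =>
        mul_le_mul_of_nonneg_left (tangent (l i) (hl i)) (hp i).le
  refine le_trans ?_ h1
  have hu : 0 ≤ P * Λ := by positivity
  generalize P * Λ = u at *
  rw [div_le_div_iff₀ (by positivity) (by positivity)]
  nlinarith [mul_nonneg hu hm0, mul_nonneg (mul_nonneg hu hm0) (sub_nonneg.2 hm1)]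

/-! ### Self-concordant functions along lines -/

/-- The quadratic form of the Hessian. -/
def hessQuad {N : ℕ} (f : EuclideanSpace ℝ (Fin N) → EReal) (x u : EuclideanSpace ℝ (Fin N)) : ℝ :=
  inner ℝ u (Matrix.toEuclideanLin (hessian (re f) x) u)

lemma inner_toEuclideanLin {ι : Type*} [Fintype ι] [DecidableEq ι] (A : Matrix ι ι ℝ)
    (u v : EuclideanSpace ℝ ι) :
    inner ℝ u (Matrix.toEuclideanLin A v) = ∑ i, ∑ j, u i * A i j * v j := by
  simp only [PiLp.inner_apply, Matrix.toLpLin_apply, Matrix.mulVec, dotProduct,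
    RCLike.inner_apply, conj_trivial, Finset.sum_mul]
  exact Finset.sum_congr rfl fun i _ => Finset.sum_congr rfl fun j _ => by ring

lemma euclidean_sum_single {ι : Type*} [Fintype ι] [DecidableEq ι] (u : EuclideanSpace ℝ ι) :
    ∑ j, u j • EuclideanSpace.single j (1 : ℝ) = u := by
  have := (EuclideanSpace.basisFun ι ℝ).sum_repr u
  simpa using this

lemma inner_hessian {N : ℕ} (h : EuclideanSpace ℝ (Fin N) → ℝ) (x u v : EuclideanSpace ℝ (Fin N)) :
    inner ℝ u (Matrix.toEuclideanLin (hessian h x) v) = fderiv ℝ (fderiv ℝ h) x u v := by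
  rw [inner_toEuclideanLin]
  conv_rhs => rw [← euclidean_sum_single u, ← euclidean_sum_single v]
  simp only [map_sum, map_smul, sum_apply, smul_apply, smul_eq_mul, hessian, Matrix.of_apply,
    iteratedFDeriv_two_apply]
  rw [Finset.sum_comm]
  refine Finset.sum_congr rfl fun i _ => ?_
  rw [Finset.mul_sum]
  refine Finset.sum_congr rfl fun j _ => ?_
  simp
  ring

lemma hessQuad_eq {N : ℕ} (f : EuclideanSpace ℝ (Fin N) → EReal)
    (x u : EuclideanSpace ℝ (Fin N)) :
    hessQuad f x u = fderiv ℝ (fderiv ℝ (re f)) x u u := inner_hessian _ _ _ _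

variable {N : ℕ} {f : EuclideanSpace ℝ (Fin N) → EReal}

lemma IsSelfConcordant.contDiffAt {M : ℝ} (hf : IsSelfConcordant M f)
    {x : EuclideanSpace ℝ (Fin N)} (hx : x ∈ dom f) : ContDiffAt ℝ 3 (re f) x :=
  hf.contDiffOn.contDiffAt (hf.isOpen_dom.mem_nhds hx)

lemma hasDerivAt_line (x u : EuclideanSpace ℝ (Fin N)) (t : ℝ) :
    HasDerivAt (fun t : ℝ => x + t • u) u t := by
  simpa using ((hasDerivAt_id t).smul_const u).const_add x

lemma hasDerivAt_comp_line {h : EuclideanSpace ℝ (Fin N) → ℝ} {x u : EuclideanSpace ℝ (Fin N)}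
    {t : ℝ} (hd : DifferentiableAt ℝ h (x + t • u)) :
    HasDerivAt (fun t : ℝ => h (x + t • u)) (inner ℝ (gradient h (x + t • u)) u) t := by
  have := hd.hasFDerivAt.comp_hasDerivAt t (hasDerivAt_line x u t)
  refine this.congr_deriv ?_
  rw [gradient, InnerProductSpace.toDual_symm_apply]

lemma inner_gradient_eq (h : EuclideanSpace ℝ (Fin N) → ℝ) (x u : EuclideanSpace ℝ (Fin N)) :
    inner ℝ (gradient h x) u = fderiv ℝ h x u := by
  rw [gradient, InnerProductSpace.toDual_symm_apply]

lemma eventually_line_mem {S : Set (EuclideanSpace ℝ (Fin N))} (hS : IsOpen S)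
    {x u : EuclideanSpace ℝ (Fin N)} {t : ℝ} (ht : x + t • u ∈ S) :
    ∀ᶠ s in nhds t, x + s • u ∈ S :=
  (hasDerivAt_line x u t).continuousAt (hS.mem_nhds ht)

lemma IsSelfConcordant.hasDerivAt_one {M : ℝ} (hf : IsSelfConcordant M f)
    {x u : EuclideanSpace ℝ (Fin N)} {t : ℝ} (ht : x + t • u ∈ dom f) :
    HasDerivAt (fun t : ℝ => re f (x + t • u)) (inner ℝ (gradient (re f) (x + t • u)) u) t :=
  hasDerivAt_comp_line ((hf.contDiffAt ht).differentiableAt (by norm_num))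

lemma IsSelfConcordant.contDiffAt_fderiv {M : ℝ} (hf : IsSelfConcordant M f)
    {x : EuclideanSpace ℝ (Fin N)} (hx : x ∈ dom f) : ContDiffAt ℝ 2 (fderiv ℝ (re f)) x :=
  (hf.contDiffAt hx).fderiv_right (by norm_num)

lemma IsSelfConcordant.contDiffAt_fderiv_fderiv {M : ℝ} (hf : IsSelfConcordant M f)
    {x : EuclideanSpace ℝ (Fin N)} (hx : x ∈ dom f) :
    ContDiffAt ℝ 1 (fderiv ℝ (fderiv ℝ (re f))) x :=
  (hf.contDiffAt_fderiv hx).fderiv_right (by norm_num)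

lemma IsSelfConcordant.hasDerivAt_two {M : ℝ} (hf : IsSelfConcordant M f)
    {x u : EuclideanSpace ℝ (Fin N)} {t : ℝ} (ht : x + t • u ∈ dom f) :
    HasDerivAt (fun t : ℝ => inner ℝ (gradient (re f) (x + t • u)) u) (hessQuad f (x + t • u) u)
      t := by
  simp only [inner_gradient_eq, hessQuad_eq]
  have h1 := ((hf.contDiffAt_fderiv ht).differentiableAt (by norm_num)).hasFDerivAt.comp_hasDerivAt
    t (hasDerivAt_line x u t)
  simpa using h1.clm_apply (hasDerivAt_const t u)

lemma IsSelfConcordant.differentiableAt_hessQuad {M : ℝ} (hf : IsSelfConcordant M f)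
    {x u : EuclideanSpace ℝ (Fin N)} {t : ℝ} (ht : x + t • u ∈ dom f) :
    DifferentiableAt ℝ (fun t : ℝ => hessQuad f (x + t • u) u) t := by
  simp only [hessQuad_eq]
  have h1 := ((hf.contDiffAt_fderiv_fderiv ht).differentiableAt
    (by norm_num)).hasFDerivAt.comp_hasDerivAt t (hasDerivAt_line x u t)
  exact ((h1.clm_apply (hasDerivAt_const t u)).clm_apply (hasDerivAt_const t u)).differentiableAt

lemma IsSelfConcordant.iteratedDeriv_two {M : ℝ} (hf : IsSelfConcordant M f)
    {x u : EuclideanSpace ℝ (Fin N)} {t : ℝ} (ht : x + t • u ∈ dom f) :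
    iteratedDeriv 2 (fun t : ℝ => re f (x + t • u)) t = hessQuad f (x + t • u) u := by
  rw [iteratedDeriv_succ, iteratedDeriv_one]
  have : deriv (fun t : ℝ => re f (x + t • u)) =ᶠ[nhds t]
      fun t => inner ℝ (gradient (re f) (x + t • u)) u := by
    filter_upwards [eventually_line_mem hf.isOpen_dom ht] with s hs
    exact (hf.hasDerivAt_one hs).deriv
  rw [this.deriv_eq, (hf.hasDerivAt_two ht).deriv]

lemma IsSelfConcordant.iteratedDeriv_three {M : ℝ} (hf : IsSelfConcordant M f)
    {x u : EuclideanSpace ℝ (Fin N)} {t : ℝ} (ht : x + t • u ∈ dom f) :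
    iteratedDeriv 3 (fun t : ℝ => re f (x + t • u)) t
      = deriv (fun t : ℝ => hessQuad f (x + t • u) u) t := by
  rw [iteratedDeriv_succ]
  refine Filter.EventuallyEq.deriv_eq ?_
  filter_upwards [eventually_line_mem hf.isOpen_dom ht] with s hs
  exact hf.iteratedDeriv_two hs

/-- The defining inequality concerns parameter 0 only; moving the base point to x + tu transports it
to every t. -/
lemma IsSelfConcordant.abs_deriv_hessQuad_le {M : ℝ} (hf : IsSelfConcordant M f)
    {x u : EuclideanSpace ℝ (Fin N)} {t : ℝ} (ht : x + t • u ∈ dom f) :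
    |deriv (fun t : ℝ => hessQuad f (x + t • u) u) t|
      ≤ M * hessQuad f (x + t • u) u ^ (3 / 2 : ℝ) := by
  have h0 : (x + t • u) + (0 : ℝ) • u ∈ dom f := by simpa using ht
  have := hf.third_deriv_le _ ht u
  rw [hf.iteratedDeriv_two h0, hf.iteratedDeriv_three h0] at this
  have e : (fun s : ℝ => hessQuad f (x + t • u + s • u) u)
      = fun s : ℝ => (fun t : ℝ => hessQuad f (x + t • u) u) (t + s) := by
    funext s
    simp only [add_smul, add_assoc]
  rw [e, deriv_comp_const_add (fun t : ℝ => hessQuad f (x + t • u) u)] at this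
  simpa using this

lemma IsSelfConcordant.isSCLine (hf : IsSelfConcordant 2 f) {x u : EuclideanSpace ℝ (Fin N)}
    {T : ℝ} (hT : ∀ t ∈ Icc 0 T, x + t • u ∈ dom f)
    (hpos : ∀ t ∈ Icc 0 T, 0 < hessQuad f (x + t • u) u) :
    IsSCLine T (fun t => re f (x + t • u)) (fun t => inner ℝ (gradient (re f) (x + t • u)) u)
      (fun t => hessQuad f (x + t • u) u) where
  d1 t ht := hf.hasDerivAt_one (hT t ht)
  d2 t ht := hf.hasDerivAt_two (hT t ht)
  d3 t ht := ⟨_, (hf.differentiableAt_hessQuad (hT t ht)).hasDerivAt,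
    hf.abs_deriv_hessQuad_le (hT t ht)⟩
  pos := hpos

/-- If the local norm of `u` at `x` is less than one, then `x + u` is in the domain and the
standard upper bound holds. -/
lemma IsSelfConcordant.upper (hf : IsSelfConcordant 2 f) {x u : EuclideanSpace ℝ (Fin N)}
    (hx : x ∈ dom f)
    (hpos : ∀ t ∈ Icc (0 : ℝ) 1, x + t • u ∈ dom f → 0 < hessQuad f (x + t • u) u)
    (hlt : Real.sqrt (hessQuad f x u) < 1) :
    x + u ∈ dom f ∧ re f (x + u) ≤ re f x + inner ℝ (gradient (re f) x) u
      + omegaStar (Real.sqrt (hessQuad f x u)) := by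
  set ρ := Real.sqrt (hessQuad f x u) with hρ
  have hρ0 : 0 ≤ ρ := Real.sqrt_nonneg _
  have bound : ∀ T ∈ Icc (0 : ℝ) 1, (∀ t ∈ Icc 0 T, x + t • u ∈ dom f) →
      re f (x + T • u) ≤ re f x + T * inner ℝ (gradient (re f) x) u + omegaStar (ρ * T) := by
    intro T hT h
    have hl := hf.isSCLine h fun t ht => hpos t ⟨ht.1, ht.2.trans hT.2⟩ (h t ht)
    have := hl.upper hT.1 (by
      simp only [zero_smul, add_zero, ← hρ]
      nlinarith [hT.2])
    simpa [← hρ] using this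
  -- Continuation argument: before a first exit time τ the bound just proved keeps f below a
  -- constant C, so closedness of f gives f ≤ C at τ as well, contradicting the exit.
  have hdom : ∀ t ∈ Icc (0 : ℝ) 1, x + t • u ∈ dom f := by
    by_contra! hne
    obtain ⟨t1, ht1, hnot⟩ := hne
    set B : Set ℝ := Icc 0 1 ∩ {t | x + t • u ∉ dom f} with hB
    have hcl : IsClosed B := by
      refine isClosed_Icc.inter ?_
      have hc : Continuous fun t : ℝ => x + t • u := by fun_prop
      exact (hf.isOpen_dom.preimage hc).isClosed_compl
    have hBne : B.Nonempty := ⟨t1, ht1, hnot⟩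
    have hbb : BddBelow B := ⟨0, fun t ht => ht.1.1⟩
    set τ := sInf B with hτ
    have hτB : τ ∈ B := hcl.csInf_mem hBne hbb
    have hbefore : ∀ t, 0 ≤ t → t < τ → x + t • u ∈ dom f := by
      intro t h0 h1
      by_contra hcon
      exact absurd (csInf_le hbb ⟨⟨h0, h1.le.trans hτB.1.2⟩, hcon⟩) (not_le.2 h1)
    have hτpos : 0 < τ := by
      rcases hτB.1.1.lt_or_eq with h | h
      · exact h
      · exfalso
        apply hτB.2
        rw [← h]
        simpa using hx
    set C := re f x + |inner ℝ (gradient (re f) x) u| + omegaStar ρ with hC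
    have hle : ∀ t, 0 ≤ t → t < τ → f (x + t • u) ≤ (C : EReal) := by
      intro t h0 h1
      have ht1 : t ≤ 1 := h1.le.trans hτB.1.2
      have hd := hbefore t h0 h1
      have hb := bound t ⟨h0, ht1⟩ fun s hs => hbefore s hs.1 (lt_of_le_of_lt hs.2 h1)
      have hm : omegaStar (ρ * t) ≤ omegaStar ρ := by
        have h2 : ρ * t ≤ ρ := mul_le_of_le_one_right hρ0 ht1
        exact omegaStar_strictMonoOn.monotoneOn ⟨by positivity, lt_of_le_of_lt h2 hlt⟩
          ⟨hρ0, hlt⟩ h2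
      have ha : t * inner ℝ (gradient (re f) x) u ≤ |inner ℝ (gradient (re f) x) u| := by
        calc _ ≤ t * |inner ℝ (gradient (re f) x) u| := by gcongr; exact le_abs_self _
          _ ≤ _ := mul_le_of_le_one_left (abs_nonneg _) ht1
      have hr : re f (x + t • u) ≤ C := by linarith
      rw [← EReal.coe_toReal hd (hf.ne_bot _)]
      exact_mod_cast hr
    have hclosed : IsClosed {y | f y ≤ (C : EReal)} := hf.closed.isClosed_preimage _
    have hc : Continuous fun t : ℝ => x + t • u := by fun_prop
    have hmem : τ ∈ closure (Ico 0 τ) := by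
      rw [closure_Ico hτpos.ne]
      exact right_mem_Icc.2 hτpos.le
    have : τ ∈ {t : ℝ | f (x + t • u) ≤ (C : EReal)} :=
      closure_minimal (fun t ht => hle t ht.1 ht.2) (hclosed.preimage hc) hmem
    apply hτB.2
    intro htop
    rw [mem_ofPred_eq, htop] at this
    exact absurd this (by simp)
  have h1 : (1 : ℝ) ∈ Icc (0 : ℝ) 1 := ⟨zero_le_one, le_rfl⟩
  refine ⟨by simpa using hdom 1 h1, by simpa using bound 1 h1 hdom⟩

/-- The standard lower bound. -/
lemma IsSelfConcordant.lower (hf : IsSelfConcordant 2 f) {x u : EuclideanSpace ℝ (Fin N)}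
    (hT : ∀ t ∈ Icc (0 : ℝ) 1, x + t • u ∈ dom f)
    (hpos : ∀ t ∈ Icc (0 : ℝ) 1, 0 < hessQuad f (x + t • u) u) :
    re f x + inner ℝ (gradient (re f) x) u
      + (Real.sqrt (hessQuad f x u) - Real.log (1 + Real.sqrt (hessQuad f x u)))
      ≤ re f (x + u) := by
  simpa using (hf.isSCLine hT hpos).lower zero_le_one

/-! ### Linear algebra -/

section Matrices

variable {ι : Type*} [Fintype ι] [DecidableEq ι]

lemma toEuclideanLin_mul_apply (A B : Matrix ι ι ℝ) (v : EuclideanSpace ℝ ι) :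
    Matrix.toEuclideanLin (A * B) v = Matrix.toEuclideanLin A (Matrix.toEuclideanLin B v) := by
  rw [Matrix.toLpLin_mul_same]; rfl

lemma toEuclideanLin_one_apply (v : EuclideanSpace ℝ ι) :
    Matrix.toEuclideanLin (1 : Matrix ι ι ℝ) v = v := by
  rw [Matrix.toLpLin_one]; rfl

lemma inner_toEuclideanLin_comm {A : Matrix ι ι ℝ} (hA : A.IsHermitian)
    (u v : EuclideanSpace ℝ ι) :
    inner ℝ (Matrix.toEuclideanLin A u) v = inner ℝ u (Matrix.toEuclideanLin A v) :=
  Matrix.isSymmetric_toEuclideanLin_iff.2 hA u v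

lemma norm_toEuclideanLin_le (A : Matrix ι ι ℝ) (v : EuclideanSpace ℝ ι) :
    ‖Matrix.toEuclideanLin A v‖ ≤ spectralNorm A * ‖v‖ :=
  (Matrix.toEuclideanCLM (n := ι) (𝕜 := ℝ) A).le_opNorm v

lemma spectralNorm_nonneg (A : Matrix ι ι ℝ) : 0 ≤ spectralNorm A := norm_nonneg _

lemma spectralNorm_le {A : Matrix ι ι ℝ} {C : ℝ} (hC : 0 ≤ C)
    (h : ∀ v, ‖Matrix.toEuclideanLin A v‖ ≤ C * ‖v‖) : spectralNorm A ≤ C :=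
  ContinuousLinearMap.opNorm_le_bound _ hC h

lemma spectralNorm_transpose (A : Matrix ι ι ℝ) : spectralNorm A.transpose = spectralNorm A := by
  have : A.transpose = star A := by
    rw [Matrix.star_eq_conjTranspose, Matrix.conjTranspose_eq_transpose_of_trivial]
  rw [this, spectralNorm, spectralNorm, map_star, ContinuousLinearMap.star_eq_adjoint,
    LinearIsometryEquiv.norm_map]

lemma inner_self_le_spectralNorm (A : Matrix ι ι ℝ) (v : EuclideanSpace ℝ ι) :
    inner ℝ v (Matrix.toEuclideanLin A v) ≤ spectralNorm A * ‖v‖ ^ 2 := by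
  calc inner ℝ v (Matrix.toEuclideanLin A v) ≤ ‖v‖ * ‖Matrix.toEuclideanLin A v‖ :=
        real_inner_le_norm _ _
    _ ≤ ‖v‖ * (spectralNorm A * ‖v‖) := by gcongr; exact norm_toEuclideanLin_le A v
    _ = _ := by ring

lemma continuous_spectralNorm : Continuous fun A : Matrix ι ι ℝ => spectralNorm A := by
  have : Continuous (Matrix.toEuclideanCLM (n := ι) (𝕜 := ℝ)).toAlgEquiv.toLinearMap :=
    LinearMap.continuous_of_finiteDimensional _
  exact this.norm

lemma posDef_inner_pos {A : Matrix ι ι ℝ} (hA : A.PosDef) {v : EuclideanSpace ℝ ι} (hv : v ≠ 0) :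
    0 < inner ℝ v (Matrix.toEuclideanLin A v) := by
  have hv' : v.ofLp ≠ 0 := fun h => hv (by ext i; simpa using congrFun h i)
  have := hA.dotProduct_mulVec_pos hv'
  have e := Matrix.inner_toEuclideanCLM A v v
  rw [show inner ℝ v (Matrix.toEuclideanLin A v) = v.ofLp ⬝ᵥ A.mulVec v.ofLp from e]
  simpa using this

lemma posDef_of_inner_pos {A : Matrix ι ι ℝ} (hA : A.IsHermitian)
    (h : ∀ v : EuclideanSpace ℝ ι, v ≠ 0 → 0 < inner ℝ v (Matrix.toEuclideanLin A v)) :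
    A.PosDef := by
  refine Matrix.PosDef.of_dotProduct_mulVec_pos hA fun x hx => ?_
  have := h (WithLp.toLp 2 x) (fun h0 => hx (by
    simpa using congrArg WithLp.ofLp h0))
  have e := Matrix.inner_toEuclideanCLM A (WithLp.toLp 2 x) (WithLp.toLp 2 x)
  rw [show inner ℝ (WithLp.toLp 2 x) (Matrix.toEuclideanLin A (WithLp.toLp 2 x))
    = x ⬝ᵥ A.mulVec x from e] at this
  simpa using this

lemma sqrt_isHermitian (A : Matrix ι ι ℝ) : (CFC.sqrt A).IsHermitian :=
  (Matrix.nonneg_iff_posSemidef.1 (CFC.sqrt_nonneg A)).isHermitian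

lemma sqrt_isUnit_det {A : Matrix ι ι ℝ} (hA : A.PosDef) : IsUnit (CFC.sqrt A).det := by
  have h := CFC.sqrt_mul_sqrt_self A hA.posSemidef.nonneg
  have hd : IsUnit A.det := (Matrix.isUnit_iff_isUnit_det A).1 hA.isUnit
  rw [← h, Matrix.det_mul] at hd
  exact isUnit_of_mul_isUnit_left hd

lemma weightedNorm_nonneg (A : Matrix ι ι ℝ) (u : EuclideanSpace ℝ ι) : 0 ≤ weightedNorm A u :=
  Real.sqrt_nonneg _

lemma norm_sqrt_sq {A : Matrix ι ι ℝ} (hA : A.PosDef) (u : EuclideanSpace ℝ ι) :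
    ‖Matrix.toEuclideanLin (CFC.sqrt A) u‖ ^ 2 = inner ℝ u (Matrix.toEuclideanLin A u) := by
  rw [← real_inner_self_eq_norm_sq, inner_toEuclideanLin_comm (sqrt_isHermitian A),
    ← toEuclideanLin_mul_apply, CFC.sqrt_mul_sqrt_self A hA.posSemidef.nonneg]

lemma weightedNorm_eq {A : Matrix ι ι ℝ} (hA : A.PosDef) (u : EuclideanSpace ℝ ι) :
    weightedNorm A u = ‖Matrix.toEuclideanLin (CFC.sqrt A) u‖ := by
  rw [weightedNorm, ← norm_sqrt_sq hA, Real.sqrt_sq (norm_nonneg _)]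

lemma weightedNorm_inv_eq {A : Matrix ι ι ℝ} (hA : A.PosDef) (u : EuclideanSpace ℝ ι) :
    weightedNorm A⁻¹ u = ‖Matrix.toEuclideanLin (CFC.sqrt A)⁻¹ u‖ := by
  rw [weightedNorm_eq hA.inv, hA.posSemidef.inv_sqrt]

lemma weightedNorm_sq {A : Matrix ι ι ℝ} (hA : A.PosDef) (u : EuclideanSpace ℝ ι) :
    weightedNorm A u ^ 2 = inner ℝ u (Matrix.toEuclideanLin A u) := by
  rw [weightedNorm_eq hA, norm_sqrt_sq hA]

lemma sqrt_mul_inv_apply {A : Matrix ι ι ℝ} (hA : A.PosDef) (u : EuclideanSpace ℝ ι) :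
    Matrix.toEuclideanLin (CFC.sqrt A) (Matrix.toEuclideanLin (CFC.sqrt A)⁻¹ u) = u := by
  rw [← toEuclideanLin_mul_apply, Matrix.mul_nonsing_inv _ (sqrt_isUnit_det hA),
    toEuclideanLin_one_apply]

lemma sqrt_inv_mul_apply {A : Matrix ι ι ℝ} (hA : A.PosDef) (u : EuclideanSpace ℝ ι) :
    Matrix.toEuclideanLin (CFC.sqrt A)⁻¹ (Matrix.toEuclideanLin (CFC.sqrt A) u) = u := by
  rw [← toEuclideanLin_mul_apply, Matrix.nonsing_inv_mul _ (sqrt_isUnit_det hA),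
    toEuclideanLin_one_apply]

/-- Cauchy--Schwarz for a norm and its dual. -/
lemma abs_inner_le_weightedNorm {A : Matrix ι ι ℝ} (hA : A.PosDef) (v d : EuclideanSpace ℝ ι) :
    |inner ℝ v d| ≤ weightedNorm A⁻¹ v * weightedNorm A d := by
  rw [weightedNorm_inv_eq hA, weightedNorm_eq hA]
  have : inner ℝ v d = inner ℝ (Matrix.toEuclideanLin (CFC.sqrt A)⁻¹ v)
      (Matrix.toEuclideanLin (CFC.sqrt A) d) := by
    rw [← inner_toEuclideanLin_comm (sqrt_isHermitian A), sqrt_mul_inv_apply hA]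
  rw [this]
  exact abs_real_inner_le_norm _ _

/-- Write v + Hd = H^½ w with w = H^(-½)v + H^½ d, move H^½ onto y, and change metric by H^½ y =
(H^½ B^(-½)) B^½ y. -/
lemma inner_add_le_of_two_metrics {H B : Matrix ι ι ℝ} (hH : H.PosDef) (hB : B.PosDef)
    (v d y : EuclideanSpace ℝ ι) :
    inner ℝ (v + Matrix.toEuclideanLin H d) y ≤
      spectralNorm (CFC.sqrt H * (CFC.sqrt B)⁻¹) * (weightedNorm H⁻¹ v + weightedNorm H d)
        * weightedNorm B y := by
  rw [weightedNorm_inv_eq hH, weightedNorm_eq hH, weightedNorm_eq hB]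
  set w := Matrix.toEuclideanLin (CFC.sqrt H)⁻¹ v + Matrix.toEuclideanLin (CFC.sqrt H) d with hw
  have e1 : v + Matrix.toEuclideanLin H d = Matrix.toEuclideanLin (CFC.sqrt H) w := by
    rw [hw, map_add, sqrt_mul_inv_apply hH, ← toEuclideanLin_mul_apply,
      CFC.sqrt_mul_sqrt_self H hH.posSemidef.nonneg]
  rw [e1, inner_toEuclideanLin_comm (sqrt_isHermitian H)]
  have e2 : Matrix.toEuclideanLin (CFC.sqrt H) y
      = Matrix.toEuclideanLin (CFC.sqrt H * (CFC.sqrt B)⁻¹)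
        (Matrix.toEuclideanLin (CFC.sqrt B) y) := by
    rw [toEuclideanLin_mul_apply, sqrt_inv_mul_apply hB]
  rw [e2]
  refine (real_inner_le_norm _ _).trans ?_
  have hw1 : ‖w‖ ≤ ‖Matrix.toEuclideanLin (CFC.sqrt H)⁻¹ v‖
      + ‖Matrix.toEuclideanLin (CFC.sqrt H) d‖ := norm_add_le _ _
  have h2 := norm_toEuclideanLin_le (CFC.sqrt H * (CFC.sqrt B)⁻¹)
    (Matrix.toEuclideanLin (CFC.sqrt B) y)
  calc _ ≤ (‖Matrix.toEuclideanLin (CFC.sqrt H)⁻¹ v‖ + ‖Matrix.toEuclideanLin (CFC.sqrt H) d‖)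
        * (spectralNorm (CFC.sqrt H * (CFC.sqrt B)⁻¹)
          * ‖Matrix.toEuclideanLin (CFC.sqrt B) y‖) := by gcongr
    _ = _ := by ring

/-- The transpose of H^(-½)B^½ is the inverse of H^½B^(-½), and transposition preserves the spectral
norm. -/
lemma one_le_spectralNorm_mul [Nonempty ι] {H B : Matrix ι ι ℝ} (hH : H.PosDef) (hB : B.PosDef) :
    1 ≤ spectralNorm (CFC.sqrt H * (CFC.sqrt B)⁻¹)
      * spectralNorm ((CFC.sqrt H)⁻¹ * CFC.sqrt B) := by
  rw [← spectralNorm_transpose ((CFC.sqrt H)⁻¹ * CFC.sqrt B), Matrix.transpose_mul,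
    Matrix.transpose_nonsing_inv]
  have hs : ∀ A : Matrix ι ι ℝ, (CFC.sqrt A).transpose = CFC.sqrt A := fun A => by
    have := sqrt_isHermitian A
    rwa [Matrix.IsHermitian, Matrix.conjTranspose_eq_transpose_of_trivial] at this
  rw [hs, hs]
  have hmul : (CFC.sqrt H * (CFC.sqrt B)⁻¹) * (CFC.sqrt B * (CFC.sqrt H)⁻¹) = 1 := by
    rw [Matrix.mul_assoc, ← Matrix.mul_assoc _ (CFC.sqrt B),
      Matrix.nonsing_inv_mul _ (sqrt_isUnit_det hB), Matrix.one_mul,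
      Matrix.mul_nonsing_inv _ (sqrt_isUnit_det hH)]
  obtain ⟨i⟩ := ‹Nonempty ι›
  set e : EuclideanSpace ℝ ι := EuclideanSpace.single i 1
  have he : ‖e‖ = 1 := by simp [e]
  calc (1 : ℝ) = ‖Matrix.toEuclideanLin ((CFC.sqrt H * (CFC.sqrt B)⁻¹)
        * (CFC.sqrt B * (CFC.sqrt H)⁻¹)) e‖ := by
        rw [hmul, toEuclideanLin_one_apply, he]
    _ ≤ spectralNorm (CFC.sqrt H * (CFC.sqrt B)⁻¹)
        * (spectralNorm (CFC.sqrt B * (CFC.sqrt H)⁻¹) * ‖e‖) := by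
        rw [toEuclideanLin_mul_apply]
        refine (norm_toEuclideanLin_le _ _).trans ?_
        gcongr
        · exact spectralNorm_nonneg _
        · exact norm_toEuclideanLin_le _ _
    _ = _ := by rw [he, mul_one]

lemma norm_sqrt_le {A : Matrix ι ι ℝ} (hA : A.PosDef) {L : ℝ}
    (h : ∀ v, inner ℝ v (Matrix.toEuclideanLin A v) ≤ L * ‖v‖ ^ 2) (v : EuclideanSpace ℝ ι) :
    ‖Matrix.toEuclideanLin (CFC.sqrt A) v‖ ≤ Real.sqrt L * ‖v‖ := by
  rw [← weightedNorm_eq hA, weightedNorm]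
  calc _ ≤ Real.sqrt (L * ‖v‖ ^ 2) := Real.sqrt_le_sqrt (h v)
    _ = _ := by rw [Real.sqrt_mul' _ (by positivity), Real.sqrt_sq (norm_nonneg _)]

lemma norm_inv_sqrt_le {A : Matrix ι ι ℝ} (hA : A.PosDef) {σ : ℝ} (hσ : 0 < σ)
    (h : ∀ v, σ * ‖v‖ ^ 2 ≤ inner ℝ v (Matrix.toEuclideanLin A v)) (v : EuclideanSpace ℝ ι) :
    ‖Matrix.toEuclideanLin (CFC.sqrt A)⁻¹ v‖ ≤ (Real.sqrt σ)⁻¹ * ‖v‖ := by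
  set u := Matrix.toEuclideanLin (CFC.sqrt A)⁻¹ v with hu
  have h1 : ‖v‖ ^ 2 = inner ℝ u (Matrix.toEuclideanLin A u) := by
    rw [← norm_sqrt_sq hA, hu, sqrt_mul_inv_apply hA]
  have h2 : Real.sqrt σ * ‖u‖ ≤ ‖v‖ := by
    apply abs_le_of_sq_le_sq' _ (norm_nonneg _) |>.2
    rw [mul_pow, Real.sq_sqrt hσ.le, h1]
    exact h u
  rw [inv_mul_eq_div, le_div_iff₀ (Real.sqrt_pos.2 hσ)]
  linarith

lemma spectralNorm_mul_le (A B : Matrix ι ι ℝ) {a c : ℝ} (ha : 0 ≤ a) (hc : 0 ≤ c)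
    (hA : ∀ v, ‖Matrix.toEuclideanLin A v‖ ≤ a * ‖v‖)
    (hB : ∀ v, ‖Matrix.toEuclideanLin B v‖ ≤ c * ‖v‖) : spectralNorm (A * B) ≤ a * c := by
  refine spectralNorm_le (by positivity) fun v => ?_
  rw [toEuclideanLin_mul_apply, mul_assoc]
  exact (hA _).trans (by gcongr; exact hB v)

/-! ### The smallest eigenvalue -/

lemma hasEigenvalue_toLin'_iff (A : Matrix ι ι ℝ) (μ : ℝ) :
    Module.End.HasEigenvalue (Matrix.toLin' A) μ ↔
      ∃ u : EuclideanSpace ℝ ι, u ≠ 0 ∧ Matrix.toEuclideanLin A u = μ • u := by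
  constructor
  · intro h
    obtain ⟨x, hx⟩ := h.exists_hasEigenvector
    refine ⟨WithLp.toLp 2 x, fun h0 => hx.2 (by simpa using congrArg WithLp.ofLp h0), ?_⟩
    have := hx.apply_eq_smul
    rw [Matrix.toLin'_apply] at this
    ext i
    simpa using congrFun this i
  · rintro ⟨u, hu, h⟩
    refine Module.End.hasEigenvalue_of_hasEigenvector (x := u.ofLp) ⟨?_, ?_⟩
    · rw [Module.End.mem_eigenspace_iff, Matrix.toLin'_apply]
      exact congrArg WithLp.ofLp h
    · exact fun h0 => hu (by ext i; simpa using congrFun h0 i)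

lemma inner_self_of_eigenvector {A : Matrix ι ι ℝ} {μ : ℝ} {u : EuclideanSpace ℝ ι}
    (h : Matrix.toEuclideanLin A u = μ • u) :
    inner ℝ u (Matrix.toEuclideanLin A u) = μ * ‖u‖ ^ 2 := by
  rw [h, inner_smul_right, real_inner_self_eq_norm_sq]

/-- The infimum of the Rayleigh quotient is attained at an eigenvector. This identifies `lambdaMin`
with the best constant in the quadratic lower bound. -/
lemma exists_min_eigenvalue [Nonempty ι] {A : Matrix ι ι ℝ} (hA : A.IsHermitian) :
    ∃ μ, Module.End.HasEigenvalue (Matrix.toLin' A) μ ∧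
      ∀ u : EuclideanSpace ℝ ι, μ * ‖u‖ ^ 2 ≤ inner ℝ u (Matrix.toEuclideanLin A u) := by
  have hs := Matrix.isSymmetric_toEuclideanLin_iff.2 hA
  have := hs.hasEigenvalue_iInf_of_finiteDimensional
  set μ := ⨅ x : { x : EuclideanSpace ℝ ι // x ≠ 0 },
    RCLike.re (inner ℝ (Matrix.toEuclideanLin A x) (x : EuclideanSpace ℝ ι))
      / ‖(x : EuclideanSpace ℝ ι)‖ ^ 2 with hμ
  refine ⟨μ, ?_, fun u => ?_⟩
  · rw [hasEigenvalue_toLin'_iff]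
    obtain ⟨x, hx⟩ := this.exists_hasEigenvector
    exact ⟨x, hx.2, hx.apply_eq_smul⟩
  · by_cases hu : u = 0
    · simp [hu]
    have hb : BddBelow (Set.range fun x : { x : EuclideanSpace ℝ ι // x ≠ 0 } =>
        RCLike.re (inner ℝ (Matrix.toEuclideanLin A x) (x : EuclideanSpace ℝ ι))
          / ‖(x : EuclideanSpace ℝ ι)‖ ^ 2) := by
      refine ⟨-spectralNorm A, ?_⟩
      rintro _ ⟨x, rfl⟩
      have hx : 0 < ‖(x : EuclideanSpace ℝ ι)‖ := norm_pos_iff.2 x.2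
      rw [le_div_iff₀ (by positivity)]
      have h1 := abs_real_inner_le_norm (Matrix.toEuclideanLin A x) (x : EuclideanSpace ℝ ι)
      have h2 := norm_toEuclideanLin_le A (x : EuclideanSpace ℝ ι)
      have h3 := (abs_le.1 h1).1
      have h4 := mul_le_mul_of_nonneg_right h2 hx.le
      simp only [RCLike.re_to_real]
      nlinarith
    have h1 := ciInf_le hb ⟨u, hu⟩
    rw [← hμ] at h1
    have hx : 0 < ‖u‖ := norm_pos_iff.2 hu
    rw [le_div_iff₀ (by positivity), RCLike.re_to_real, hs] at h1
    exact h1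

lemma lambdaMin_mul_le [Nonempty ι] {A : Matrix ι ι ℝ} (hA : A.IsHermitian)
    (u : EuclideanSpace ℝ ι) :
    lambdaMin A * ‖u‖ ^ 2 ≤ inner ℝ u (Matrix.toEuclideanLin A u) := by
  obtain ⟨μ, h1, h2⟩ := exists_min_eigenvalue hA
  refine le_trans ?_ (h2 u)
  gcongr
  refine csInf_le ⟨μ, fun ν hν => ?_⟩ h1
  obtain ⟨w, hw, he⟩ := (hasEigenvalue_toLin'_iff A ν).1 hν
  have := h2 w
  rw [inner_self_of_eigenvector he] at this
  have hx : 0 < ‖w‖ := norm_pos_iff.2 hw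
  exact le_of_mul_le_mul_right this (by positivity)

lemma le_lambdaMin [Nonempty ι] {A : Matrix ι ι ℝ} (hA : A.IsHermitian) {m : ℝ}
    (h : ∀ u : EuclideanSpace ℝ ι, m * ‖u‖ ^ 2 ≤ inner ℝ u (Matrix.toEuclideanLin A u)) :
    m ≤ lambdaMin A := by
  obtain ⟨μ, h1, -⟩ := exists_min_eigenvalue hA
  refine le_csInf ⟨μ, h1⟩ fun ν hν => ?_
  obtain ⟨w, hw, he⟩ := (hasEigenvalue_toLin'_iff A ν).1 hν
  have := h w
  rw [inner_self_of_eigenvector he] at this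
  have hx : 0 < ‖w‖ := norm_pos_iff.2 hw
  exact le_of_mul_le_mul_right this (by positivity)

end Matrices

/-! ### Blocks -/

section Blocks

variable {N n : ℕ} (b : Fin N → Fin n)

/-- The vector with `i`-th block `d` and all other blocks zero. -/
def embBlk (i : Fin n) : Block b i →ₗ[ℝ] EuclideanSpace ℝ (Fin N) where
  toFun d := WithLp.toLp 2 fun j => if hj : b j = i then d ⟨j, hj⟩ else 0
  map_add' d e := by
    ext j
    by_cases hj : b j = i <;> simp [hj]
  map_smul' c d := by
    ext j
    by_cases hj : b j = i <;> simp [hj]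

/-- Taking a block, as a linear map. -/
def blkLin (i : Fin n) : EuclideanSpace ℝ (Fin N) →ₗ[ℝ] Block b i where
  toFun := blk b i
  map_add' x y := by ext j; simp [blk]
  map_smul' c x := by ext j; simp [blk]

lemma blk_add (i : Fin n) (x y : EuclideanSpace ℝ (Fin N)) :
    blk b i (x + y) = blk b i x + blk b i y := (blkLin b i).map_add x y

lemma blk_sub (i : Fin n) (x y : EuclideanSpace ℝ (Fin N)) :
    blk b i (x - y) = blk b i x - blk b i y := (blkLin b i).map_sub x y

lemma blk_smul (i : Fin n) (c : ℝ) (x : EuclideanSpace ℝ (Fin N)) :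
    blk b i (c • x) = c • blk b i x := (blkLin b i).map_smul c x

lemma continuous_blk (i : Fin n) : Continuous (blk b i) :=
  LinearMap.continuous_of_finiteDimensional (blkLin b i)

lemma addBlk_eq (i : Fin n) (x : EuclideanSpace ℝ (Fin N)) (d : Block b i) :
    addBlk b i x d = x + embBlk b i d := by
  ext j
  by_cases hj : b j = i <;> simp [addBlk, embBlk, hj]

lemma blk_embBlk_same (i : Fin n) (d : Block b i) : blk b i (embBlk b i d) = d := by
  ext ⟨j, hj⟩
  simp [blk, embBlk, hj]

lemma blk_embBlk_ne {i k : Fin n} (h : k ≠ i) (d : Block b i) : blk b k (embBlk b i d) = 0 := by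
  ext ⟨j, hj⟩
  have : b j ≠ i := by rw [hj]; exact h
  simp [blk, embBlk, this]

lemma inner_eq_sum_blk (x y : EuclideanSpace ℝ (Fin N)) :
    inner ℝ x y = ∑ i, inner ℝ (blk b i x) (blk b i y) := by
  simp only [PiLp.inner_apply, blk]
  exact (Fintype.sum_fiberwise b fun j => inner ℝ (x j) (y j)).symm

lemma inner_embBlk (i : Fin n) (y : EuclideanSpace ℝ (Fin N)) (d : Block b i) :
    inner ℝ y (embBlk b i d) = inner ℝ (blk b i y) d := by
  rw [inner_eq_sum_blk b, Finset.sum_eq_single i, blk_embBlk_same]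
  · intro k _ hk
    rw [blk_embBlk_ne b hk, inner_zero_right]
  · simp

lemma norm_sq_eq_sum_blk (x : EuclideanSpace ℝ (Fin N)) : ‖x‖ ^ 2 = ∑ i, ‖blk b i x‖ ^ 2 := by
  simp only [← real_inner_self_eq_norm_sq]
  exact inner_eq_sum_blk b x x

lemma norm_embBlk (i : Fin n) (d : Block b i) : ‖embBlk b i d‖ = ‖d‖ := by
  have : ‖embBlk b i d‖ ^ 2 = ‖d‖ ^ 2 := by
    rw [← real_inner_self_eq_norm_sq, inner_embBlk, blk_embBlk_same, real_inner_self_eq_norm_sq]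
  exact (sq_eq_sq₀ (norm_nonneg _) (norm_nonneg _)).1 this

lemma blk_toEuclideanLin_embBlk (M : Matrix (Fin N) (Fin N) ℝ) (i : Fin n) (d : Block b i) :
    blk b i (Matrix.toEuclideanLin M (embBlk b i d))
      = Matrix.toEuclideanLin (diagBlk b i M) d := by
  ext ⟨j, hj⟩
  simp only [blk, Matrix.toLpLin_apply, Matrix.mulVec, dotProduct, diagBlk,
    Matrix.submatrix_apply, embBlk, LinearMap.coe_mk, AddHom.coe_mk]
  have h := Finset.sum_subtype (Finset.univ.filter fun k => b k = i) (p := fun k => b k = i)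
    (F := inferInstance) (by simp) (fun k => M j k * if hk : b k = i then d ⟨k, hk⟩ else 0)
  rw [Finset.sum_filter] at h
  refine Eq.trans (Finset.sum_congr rfl fun k _ => ?_)
    (h.trans (Finset.sum_congr rfl fun k _ => ?_))
  · by_cases hk : b k = i <;> simp [hk]
  · simp [k.2]

/-- A diagonal block is the compression of the matrix to a coordinate subspace, so quadratic bounds
on the matrix pass to its blocks. -/
lemma inner_diagBlk (M : Matrix (Fin N) (Fin N) ℝ) (i : Fin n) (d e : Block b i) :
    inner ℝ e (Matrix.toEuclideanLin (diagBlk b i M) d)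
      = inner ℝ (embBlk b i e) (Matrix.toEuclideanLin M (embBlk b i d)) := by
  rw [← blk_toEuclideanLin_embBlk, real_inner_comm, ← inner_embBlk, real_inner_comm]

lemma blk_blkDiag (M : Matrix (Fin N) (Fin N) ℝ) (i : Fin n) (y : EuclideanSpace ℝ (Fin N)) :
    blk b i (Matrix.toEuclideanLin (blkDiag b M) y)
      = Matrix.toEuclideanLin (diagBlk b i M) (blk b i y) := by
  rw [← blk_toEuclideanLin_embBlk]
  ext ⟨j, hj⟩
  simp only [blk, Matrix.toLpLin_apply, Matrix.mulVec, dotProduct, blkDiag, Matrix.of_apply,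
    embBlk, LinearMap.coe_mk, AddHom.coe_mk]
  refine Finset.sum_congr rfl fun k _ => ?_
  by_cases hk : b k = i
  · simp [hk, hj]
  · have : ¬ i = b k := fun h => hk h.symm
    simp [hk, hj, this]

lemma blk_ext {x y : EuclideanSpace ℝ (Fin N)} (h : ∀ i, blk b i x = blk b i y) : x = y := by
  ext j
  exact congrArg (fun v : Block b (b j) => v ⟨j, rfl⟩) (h (b j))

lemma posDef_diagBlk {M : Matrix (Fin N) (Fin N) ℝ} (hM : M.PosDef) (i : Fin n) :
    (diagBlk b i M).PosDef := hM.submatrix Subtype.val_injective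

lemma inner_blkDiag (M : Matrix (Fin N) (Fin N) ℝ) (u v : EuclideanSpace ℝ (Fin N)) :
    inner ℝ u (Matrix.toEuclideanLin (blkDiag b M) v)
      = ∑ i, inner ℝ (blk b i u) (Matrix.toEuclideanLin (diagBlk b i M) (blk b i v)) := by
  rw [inner_eq_sum_blk b]
  exact Finset.sum_congr rfl fun i _ => by rw [blk_blkDiag]

lemma posDef_blkDiag {M : Matrix (Fin N) (Fin N) ℝ} (hM : M.PosDef) : (blkDiag b M).PosDef := by
  refine posDef_of_inner_pos ?_ fun v hv => ?_
  · ext j k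
    have := hM.isHermitian.apply j k
    simp only [star_trivial] at this
    simp [blkDiag, this, eq_comm]
  · rw [inner_blkDiag]
    have : ∃ i, blk b i v ≠ 0 := by
      by_contra! h
      exact hv (blk_ext b fun i => by rw [h i]; exact ((blkLin b i).map_zero).symm)
    obtain ⟨i, hi⟩ := this
    refine Finset.sum_pos' (fun k _ => ?_) ⟨i, Finset.mem_univ i, posDef_inner_pos
      (posDef_diagBlk b hM i) hi⟩
    by_cases hk : blk b k v = 0
    · simp [hk]
    · exact (posDef_inner_pos (posDef_diagBlk b hM k) hk).le

/-- The vector with the given blocks. -/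
def ofBlks (d : ∀ i, Block b i) : EuclideanSpace ℝ (Fin N) := WithLp.toLp 2 fun j => d (b j) ⟨j, rfl⟩

lemma blk_ofBlks (d : ∀ i, Block b i) (i : Fin n) : blk b i (ofBlks b d) = d i := by
  ext ⟨j, hj⟩
  subst hj
  rfl

lemma weightedNorm_blkDiag {M : Matrix (Fin N) (Fin N) ℝ} (hM : M.PosDef)
    (v : EuclideanSpace ℝ (Fin N)) :
    weightedNorm (blkDiag b M) v
      = Real.sqrt (∑ i, weightedNorm (diagBlk b i M) (blk b i v) ^ 2) := by
  rw [weightedNorm, inner_blkDiag]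
  congr 1
  exact Finset.sum_congr rfl fun i _ => (weightedNorm_sq (posDef_diagBlk b hM i) _).symm

lemma weightedNorm_blkDiag_inv {M : Matrix (Fin N) (Fin N) ℝ} (hM : M.PosDef)
    (v : EuclideanSpace ℝ (Fin N)) :
    weightedNorm (blkDiag b M)⁻¹ v
      = Real.sqrt (∑ i, weightedNorm (diagBlk b i M)⁻¹ (blk b i v) ^ 2) := by
  have hd : ∀ i, IsUnit (diagBlk b i M).det := fun i =>
    (Matrix.isUnit_iff_isUnit_det _).1 (posDef_diagBlk b hM i).isUnit
  have hD : IsUnit (blkDiag b M).det :=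
    (Matrix.isUnit_iff_isUnit_det _).1 (posDef_blkDiag b hM).isUnit
  -- Solving the block diagonal system block by block avoids computing the inverse matrix.
  set u := ofBlks b fun i => Matrix.toEuclideanLin (diagBlk b i M)⁻¹ (blk b i v) with hu
  have h1 : Matrix.toEuclideanLin (blkDiag b M) u = v := by
    refine blk_ext b fun i => ?_
    rw [blk_blkDiag, hu, blk_ofBlks, ← toEuclideanLin_mul_apply,
      Matrix.mul_nonsing_inv _ (hd i), toEuclideanLin_one_apply]
  have h2 : Matrix.toEuclideanLin (blkDiag b M)⁻¹ v = u := by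
    rw [← h1, ← toEuclideanLin_mul_apply, Matrix.nonsing_inv_mul _ hD, toEuclideanLin_one_apply]
  rw [weightedNorm, h2, inner_eq_sum_blk b]
  congr 1
  refine Finset.sum_congr rfl fun i _ => ?_
  rw [weightedNorm_sq (posDef_diagBlk b hM i).inv, hu, blk_ofBlks]

lemma inner_blkDiag_le {M : Matrix (Fin N) (Fin N) ℝ} {L : ℝ}
    (h : ∀ v, inner ℝ v (Matrix.toEuclideanLin M v) ≤ L * ‖v‖ ^ 2)
    (v : EuclideanSpace ℝ (Fin N)) :
    inner ℝ v (Matrix.toEuclideanLin (blkDiag b M) v) ≤ L * ‖v‖ ^ 2 := by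
  rw [inner_blkDiag, norm_sq_eq_sum_blk b, Finset.mul_sum]
  refine Finset.sum_le_sum fun i _ => ?_
  rw [inner_diagBlk, ← norm_embBlk]
  exact h _

lemma le_inner_blkDiag {M : Matrix (Fin N) (Fin N) ℝ} {σ : ℝ}
    (h : ∀ v, σ * ‖v‖ ^ 2 ≤ inner ℝ v (Matrix.toEuclideanLin M v))
    (v : EuclideanSpace ℝ (Fin N)) :
    σ * ‖v‖ ^ 2 ≤ inner ℝ v (Matrix.toEuclideanLin (blkDiag b M) v) := by
  rw [inner_blkDiag, norm_sq_eq_sum_blk b, Finset.mul_sum]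
  refine Finset.sum_le_sum fun i _ => ?_
  rw [inner_diagBlk, ← norm_embBlk]
  exact h _

end Blocks

/-! ### The objective function -/

lemma coe_re {V : Type*} {h : V → EReal} (hb : ∀ x, h x ≠ ⊥) {x : V} (hx : x ∈ dom h) :
    ((re h x : ℝ) : EReal) = h x := EReal.coe_toReal hx (hb x)

lemma ereal_sum_ne_bot {ι : Type*} (s : Finset ι) {a : ι → EReal} (h : ∀ i, a i ≠ ⊥) :
    ∑ i ∈ s, a i ≠ ⊥ := by
  classical
  induction s using Finset.induction_on with
  | empty => simp
  | insert i s hi ih =>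
    rw [Finset.sum_insert hi]
    exact EReal.add_ne_bot_iff.2 ⟨h i, ih⟩

lemma ereal_sum_coe {ι : Type*} (s : Finset ι) (r : ι → ℝ) :
    ∑ i ∈ s, (r i : EReal) = ((∑ i ∈ s, r i : ℝ) : EReal) := by
  classical
  induction s using Finset.induction_on with
  | empty => simp
  | insert i s hi ih => rw [Finset.sum_insert hi, Finset.sum_insert hi, ih, EReal.coe_add]

lemma ereal_sum_ne_top {ι : Type*} (s : Finset ι) {a : ι → EReal} (hb : ∀ i, a i ≠ ⊥)
    (h : ∑ i ∈ s, a i ≠ ⊤) : ∀ i ∈ s, a i ≠ ⊤ := by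
  classical
  intro i hi ht
  apply h
  rw [← Finset.add_sum_erase s a hi, ht]
  exact EReal.top_add_of_ne_bot (ereal_sum_ne_bot _ hb)

section Problem

variable {N n : ℕ} {b : Fin N → Fin n} {f : EuclideanSpace ℝ (Fin N) → EReal}
  {g : (i : Fin n) → Block b i → EReal}

lemma gSum_ne_bot (hg : ∀ i, IsProperClosedConvex (g i)) (x : EuclideanSpace ℝ (Fin N)) :
    gSum b g x ≠ ⊥ := ereal_sum_ne_bot _ fun i => (hg i).ne_bot _

lemma mem_dom_gSum (hg : ∀ i, IsProperClosedConvex (g i)) {x : EuclideanSpace ℝ (Fin N)} :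
    x ∈ dom (gSum b g) ↔ ∀ i, blk b i x ∈ dom (g i) := by
  constructor
  · intro h i
    exact ereal_sum_ne_top Finset.univ (fun i => (hg i).ne_bot _) h i (Finset.mem_univ i)
  · intro h
    have : gSum b g x = ((∑ i, re (g i) (blk b i x) : ℝ) : EReal) := by
      rw [gSum, ← ereal_sum_coe]
      exact Finset.sum_congr rfl fun i _ => (coe_re (hg i).ne_bot (h i)).symm
    simp [dom, this]

lemma re_gSum (hg : ∀ i, IsProperClosedConvex (g i)) {x : EuclideanSpace ℝ (Fin N)}
    (hx : x ∈ dom (gSum b g)) : re (gSum b g) x = ∑ i, re (g i) (blk b i x) := by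
  have h := (mem_dom_gSum hg).1 hx
  have : gSum b g x = ((∑ i, re (g i) (blk b i x) : ℝ) : EReal) := by
    rw [gSum, ← ereal_sum_coe]
    exact Finset.sum_congr rfl fun i _ => (coe_re (hg i).ne_bot (h i)).symm
  simp [re, this]

namespace IsCompositeSCProblem

lemma objective_ne_bot (hprob : IsCompositeSCProblem b f g)
    (x : EuclideanSpace ℝ (Fin N)) : objective b f g x ≠ ⊥ :=
  EReal.add_ne_bot_iff.2
    ⟨hprob.selfConcordant.ne_bot x, gSum_ne_bot hprob.properClosedConvex x⟩

lemma mem_dom (hprob : IsCompositeSCProblem b f g) {x : EuclideanSpace ℝ (Fin N)} :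
    x ∈ dom (objective b f g) ↔ x ∈ dom f ∧ x ∈ dom (gSum b g) := by
  constructor
  · intro h
    refine ⟨fun ht => h ?_, fun ht => h ?_⟩
    · rw [objective, ht]
      exact EReal.top_add_of_ne_bot (gSum_ne_bot hprob.properClosedConvex x)
    · rw [objective, ht]
      exact EReal.add_top_of_ne_bot (hprob.selfConcordant.ne_bot x)
  · rintro ⟨h1, h2⟩
    exact EReal.add_ne_top h1 h2

lemma re_eq (hprob : IsCompositeSCProblem b f g)
    {x : EuclideanSpace ℝ (Fin N)} (hx : x ∈ dom (objective b f g)) :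
    re (objective b f g) x = re f x + re (gSum b g) x := by
  have h := hprob.mem_dom.1 hx
  exact EReal.toReal_add h.1 (hprob.selfConcordant.ne_bot x) h.2
    (gSum_ne_bot hprob.properClosedConvex x)

lemma convexOn_gSum (hprob : IsCompositeSCProblem b f g) :
    ConvexOn ℝ (dom (gSum b g)) (re (gSum b g)) := by
  have hg := hprob.properClosedConvex
  have hc : Convex ℝ (dom (gSum b g)) := by
    intro x hx y hy s t hs ht hst
    rw [mem_dom_gSum hg] at *
    intro i
    rw [blk_add, blk_smul, blk_smul]
    exact (hg i).convex.1 (hx i) (hy i) hs ht hst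
  refine ⟨hc, fun x hx y hy s t hs ht hst => ?_⟩
  rw [re_gSum hg hx, re_gSum hg hy, re_gSum hg (hc hx hy hs ht hst), smul_eq_mul, smul_eq_mul,
    Finset.mul_sum, Finset.mul_sum, ← Finset.sum_add_distrib]
  rw [mem_dom_gSum hg] at hx hy
  refine Finset.sum_le_sum fun i _ => ?_
  rw [blk_add, blk_smul, blk_smul]
  exact (hg i).convex.2 (hx i) (hy i) hs ht hst

lemma convexOn (hprob : IsCompositeSCProblem b f g) :
    ConvexOn ℝ (dom (objective b f g)) (re (objective b f g)) := by
  have hd : dom (objective b f g) = dom f ∩ dom (gSum b g) := by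
    ext x
    exact hprob.mem_dom
  have hc : Convex ℝ (dom (objective b f g)) := by
    rw [hd]
    exact hprob.selfConcordant.convex.1.inter hprob.convexOn_gSum.1
  refine ⟨hc, fun x hx y hy s t hs ht hst => ?_⟩
  rw [hprob.re_eq hx, hprob.re_eq hy, hprob.re_eq (hc hx hy hs ht hst)]
  have h1 := hprob.selfConcordant.convex.2 (hprob.mem_dom.1 hx).1 (hprob.mem_dom.1 hy).1 hs ht hst
  have h2 := hprob.convexOn_gSum.2 (hprob.mem_dom.1 hx).2 (hprob.mem_dom.1 hy).2 hs ht hst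
  simp only [smul_eq_mul] at *
  linarith

lemma lowerSemicontinuous (hprob : IsCompositeSCProblem b f g) :
    LowerSemicontinuous (objective b f g) := by
  have hadd : ∀ {u v : EuclideanSpace ℝ (Fin N) → EReal}, LowerSemicontinuous u →
      LowerSemicontinuous v → (∀ x, u x ≠ ⊥) → (∀ x, v x ≠ ⊥) →
      -- Addition of extended reals is continuous here because neither summand takes the value -∞.
      LowerSemicontinuous fun x => u x + v x := fun hu hv hu' hv' =>
    hu.add' hv fun x => EReal.continuousAt_add (Or.inr (hv' x)) (Or.inl (hu' x))
  have hs : ∀ s : Finset (Fin n), LowerSemicontinuous fun x => ∑ i ∈ s, g i (blk b i x) := by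
    intro s
    induction s using Finset.induction_on with
    | empty =>
      simp only [Finset.sum_empty]
      exact lowerSemicontinuous_const
    | insert i s hi ih =>
      simp only [Finset.sum_insert hi]
      exact hadd ((hprob.properClosedConvex i).closed.comp (continuous_blk b i)) ih
        (fun x => (hprob.properClosedConvex i).ne_bot _)
        (fun x => ereal_sum_ne_bot _ fun i => (hprob.properClosedConvex i).ne_bot _)
  exact hadd hprob.selfConcordant.closed (hs Finset.univ) hprob.selfConcordant.ne_bot
    (gSum_ne_bot hprob.properClosedConvex)

lemma mem_sublevel (hprob : IsCompositeSCProblem b f g)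
    {x0 : EuclideanSpace ℝ (Fin N)} (hx0 : x0 ∈ dom (objective b f g))
    {x : EuclideanSpace ℝ (Fin N)} :
    x ∈ sublevel (objective b f g) x0 ↔
      x ∈ dom (objective b f g) ∧ re (objective b f g) x ≤ re (objective b f g) x0 := by
  rw [sublevel, mem_ofPred_eq]
  constructor
  · intro h
    have hx : x ∈ dom (objective b f g) := (lt_of_le_of_lt h (lt_top_iff_ne_top.2 hx0)).ne
    refine ⟨hx, ?_⟩
    rw [← coe_re hprob.objective_ne_bot hx, ← coe_re hprob.objective_ne_bot hx0] at h
    exact_mod_cast h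
  · rintro ⟨hx, h⟩
    rw [← coe_re hprob.objective_ne_bot hx, ← coe_re hprob.objective_ne_bot hx0]
    exact_mod_cast h

lemma convex_sublevel (hprob : IsCompositeSCProblem b f g)
    {x0 : EuclideanSpace ℝ (Fin N)} (hx0 : x0 ∈ dom (objective b f g)) :
    Convex ℝ (sublevel (objective b f g) x0) := by
  have h := hprob.convexOn.convex_le (re (objective b f g) x0)
  convert h using 1
  ext x
  exact hprob.mem_sublevel hx0

lemma isClosed_sublevel (hprob : IsCompositeSCProblem b f g) (x0 : EuclideanSpace ℝ (Fin N)) :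
    IsClosed (sublevel (objective b f g) x0) := hprob.lowerSemicontinuous.isClosed_preimage _

/-- On the part of the unit sphere around the minimizer z lying in S, F attains a minimum, which
exceeds F(z) by uniqueness. Convexity then forces at least linear growth along rays from z, so S is
bounded; if the sphere misses S, convexity keeps S in the unit ball. -/
lemma isCompact_sublevel (hprob : IsCompositeSCProblem b f g)
    {x0 : EuclideanSpace ℝ (Fin N)} (hx0 : x0 ∈ dom (objective b f g)) :
    IsCompact (sublevel (objective b f g) x0) := by
  set F := objective b f g with hF
  set S := sublevel F x0 with hS
  obtain ⟨z, hz, hzu⟩ := hprob.existsUnique_min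
  have hzS : z ∈ S := hz x0
  have hzd := ((hprob.mem_sublevel hx0).1 hzS).1
  have hconv := hprob.convex_sublevel hx0
  have hcS := hprob.isClosed_sublevel x0
  have key : ∃ C, ∀ y ∈ S, ‖y - z‖ ≤ C := by
    have point : ∀ y ∈ S, 1 < ‖y - z‖ → z + ‖y - z‖⁻¹ • (y - z) ∈ S ∩ Metric.sphere z 1 := by
      intro y hy hR
      refine ⟨hconv.add_smul_sub_mem hzS hy ⟨by positivity, inv_le_one_of_one_le₀ hR.le⟩, ?_⟩
      have : ‖y - z‖ ≠ 0 := by positivity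
      rw [mem_sphere_iff_norm, add_sub_cancel_left, norm_smul, norm_inv, norm_norm,
        inv_mul_cancel₀ this]
    by_cases hne : (S ∩ Metric.sphere z 1).Nonempty
    · have hcomp : IsCompact (S ∩ Metric.sphere z 1) := (isCompact_sphere z 1).inter_left hcS
      obtain ⟨w, hw, hwmin⟩ :=
        LowerSemicontinuousOn.exists_isMinOn hne hcomp
          (hprob.lowerSemicontinuous.lowerSemicontinuousOn _)
      have hwd := ((hprob.mem_sublevel hx0).1 hw.1)
      have hlt : re F z < re F w := by
        by_contra! hle
        have hw2 : ∀ y, F w ≤ F y := fun y => by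
          refine le_trans ?_ (hz y)
          rw [hF, ← coe_re hprob.objective_ne_bot hwd.1, ← coe_re hprob.objective_ne_bot hzd]
          exact_mod_cast hle
        have := hzu w hw2
        have h2 := hw.2
        rw [this] at h2
        simp at h2
      refine ⟨max 1 ((re F x0 - re F z) / (re F w - re F z)), fun y hy => ?_⟩
      by_cases hR : ‖y - z‖ ≤ 1
      · exact hR.trans (le_max_left _ _)
      push Not at hR
      refine le_trans ?_ (le_max_right _ _)
      have hp := point y hy hR
      have hyd := (hprob.mem_sublevel hx0).1 hy
      have hpd := (hprob.mem_sublevel hx0).1 hp.1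
      have h1 : re F w ≤ re F (z + ‖y - z‖⁻¹ • (y - z)) := by
        have := hwmin hp
        rw [mem_ofPred_eq, ← coe_re hprob.objective_ne_bot hwd.1,
          ← coe_re hprob.objective_ne_bot hpd.1] at this
        exact_mod_cast this
      set R := ‖y - z‖ with hRdef
      have hRp : 0 < R := by linarith
      have h2 : re F (z + R⁻¹ • (y - z)) ≤ (1 - R⁻¹) * re F z + R⁻¹ * re F y := by
        have := hprob.convexOn.2 hzd hyd.1 (sub_nonneg.2 (inv_le_one_of_one_le₀ hR.le))
          (inv_nonneg.2 hRp.le) (by ring)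
        have e : z + R⁻¹ • (y - z) = (1 - R⁻¹) • z + R⁻¹ • y := by module
        rw [e]
        exact this
      rw [le_div_iff₀ (sub_pos.2 hlt)]
      have h3 : re F w - re F z ≤ R⁻¹ * (re F x0 - re F z) := by
        have := mul_le_mul_of_nonneg_left hyd.2 (inv_nonneg.2 hRp.le)
        linarith
      calc R * (re F w - re F z) ≤ R * (R⁻¹ * (re F x0 - re F z)) := by gcongr
        _ = _ := by field_simp
    · refine ⟨1, fun y hy => ?_⟩
      by_contra! hR
      exact hne ⟨_, point y hy hR⟩
  obtain ⟨C, hC⟩ := key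
  exact (isCompact_closedBall z C).of_isClosed_subset hcS fun y hy => by
    rw [mem_closedBall_iff_norm]
    exact hC y hy

end IsCompositeSCProblem

/-! ### The constants -/

lemma IsSelfConcordant.continuousOn_hessQuad {M : ℝ} (hf : IsSelfConcordant M f) :
    ContinuousOn (fun z : EuclideanSpace ℝ (Fin N) × EuclideanSpace ℝ (Fin N) =>
      hessQuad f z.1 z.2) (dom f ×ˢ univ) := by
  intro z hz
  simp only [hessQuad_eq]
  have h := (hf.contDiffAt_fderiv_fderiv hz.1).continuousAt
  have h1 : ContinuousAt (fun z : EuclideanSpace ℝ (Fin N) × EuclideanSpace ℝ (Fin N) =>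
      fderiv ℝ (fderiv ℝ (re f)) z.1) z := h.comp continuousAt_fst
  exact ((h1.clm_apply continuousAt_snd).clm_apply continuousAt_snd).continuousWithinAt

lemma IsSelfConcordant.continuousOn_hessian {M : ℝ} (hf : IsSelfConcordant M f) :
    ContinuousOn (hessian (re f)) (dom f) := by
  intro x hx
  refine ContinuousAt.continuousWithinAt ?_
  refine continuousAt_pi.2 fun j => continuousAt_pi.2 fun k => ?_
  simp only [hessian, Matrix.of_apply, iteratedFDeriv_two_apply]
  have h := (hf.contDiffAt_fderiv_fderiv hx).continuousAt
  exact (h.clm_apply continuousAt_const).clm_apply continuousAt_const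

variable {S : Set (EuclideanSpace ℝ (Fin N))}

lemma sigmaF_pos_and_le (hN : 0 < N) (hf : IsSelfConcordant 2 f) (hS : IsCompact S)
    (hne : S.Nonempty) (hSd : S ⊆ dom f) (hpd : ∀ x ∈ S, (hessian (re f) x).PosDef) :
    0 < sigmaF f S ∧ ∀ x ∈ S, ∀ u, sigmaF f S * ‖u‖ ^ 2 ≤ hessQuad f x u := by
  have : Nonempty (Fin N) := ⟨⟨0, hN⟩⟩
  have hsne : (Metric.sphere (0 : EuclideanSpace ℝ (Fin N)) 1).Nonempty :=
    ⟨EuclideanSpace.single ⟨0, hN⟩ 1, by simp⟩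
  -- Minimizing the quadratic form jointly over S and the unit sphere gives a positive lower bound
  -- for all eigenvalues at once, without continuity of `lambdaMin`.
  obtain ⟨z, hz, hzmin⟩ := (hS.prod (isCompact_sphere (0 : EuclideanSpace ℝ (Fin N))
    1)).exists_isMinOn (hne.prod hsne) (hf.continuousOn_hessQuad.mono
      (prod_mono hSd (subset_univ _)))
  have hz2 : z.2 ≠ 0 := by
    have := hz.2
    rw [mem_sphere_zero_iff_norm] at this
    intro h
    simp [h] at this
  have hm : 0 < hessQuad f z.1 z.2 := posDef_inner_pos (hpd _ hz.1) hz2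
  set m := hessQuad f z.1 z.2 with hmdef
  have hbound : ∀ x ∈ S, ∀ u : EuclideanSpace ℝ (Fin N),
      m * ‖u‖ ^ 2 ≤ inner ℝ u (Matrix.toEuclideanLin (hessian (re f) x) u) := by
    intro x hx u
    by_cases hu : u = 0
    · simp [hu]
    have hun : 0 < ‖u‖ := norm_pos_iff.2 hu
    have hmem : (x, ‖u‖⁻¹ • u) ∈ S ×ˢ Metric.sphere (0 : EuclideanSpace ℝ (Fin N)) 1 := by
      refine ⟨hx, ?_⟩
      rw [mem_sphere_zero_iff_norm, norm_smul, norm_inv, norm_norm, inv_mul_cancel₀ hun.ne']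
    have h1 := hzmin hmem
    simp only [mem_ofPred_eq, ← hmdef] at h1
    rw [hessQuad, map_smul, inner_smul_left, inner_smul_right] at h1
    simp only [RCLike.conj_to_real] at h1
    calc m * ‖u‖ ^ 2 ≤ (‖u‖⁻¹ * (‖u‖⁻¹ * inner ℝ u
          (Matrix.toEuclideanLin (hessian (re f) x) u))) * ‖u‖ ^ 2 := by gcongr
      _ = _ := by field_simp
  have hl : ∀ x ∈ S, m ≤ lambdaMin (hessian (re f) x) := fun x hx =>
    le_lambdaMin (hpd x hx).isHermitian (hbound x hx)
  constructor
  · refine lt_of_lt_of_le hm (le_csInf (hne.image _) ?_)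
    rintro _ ⟨x, hx, rfl⟩
    exact hl x hx
  · intro x hx u
    refine le_trans ?_ (lambdaMin_mul_le (hpd x hx).isHermitian u)
    gcongr
    refine csInf_le ⟨m, ?_⟩ ⟨x, hx, rfl⟩
    rintro _ ⟨y, hy, rfl⟩
    exact hl y hy

lemma hessQuad_le_LF (hf : IsSelfConcordant 2 f) (hS : IsCompact S) (hSd : S ⊆ dom f) :
    ∀ x ∈ S, ∀ u, hessQuad f x u ≤ LF f S * ‖u‖ ^ 2 := by
  intro x hx u
  refine (inner_self_le_spectralNorm _ u).trans ?_
  gcongr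
  exact le_csSup (hS.bddAbove_image
    (continuous_spectralNorm.comp_continuousOn (hf.continuousOn_hessian.mono hSd))) ⟨x, hx, rfl⟩

/-- The quantity whose maximum occurs in `c₁`. -/
def condTerm (b : Fin N → Fin n) (f : EuclideanSpace ℝ (Fin N) → EReal) (η : ℝ)
    (x : EuclideanSpace ℝ (Fin N)) : ℝ :=
  (1 + η) * spectralNorm
      (CFC.sqrt (blkDiag b (hessian (re f) x)) * (CFC.sqrt (hessian (re f) x))⁻¹)
    + spectralNorm ((CFC.sqrt (blkDiag b (hessian (re f) x)))⁻¹ * CFC.sqrt (hessian (re f) x))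

/-- Only boundedness on S is needed, and both spectral norms are at most √L_f/√σ_f since the block
diagonal part inherits the quadratic bounds of the Hessian. Continuity of the matrix square root is
not required. -/
lemma condTerm_le_sSup (hN : 0 < N) (hf : IsSelfConcordant 2 f) (hS : IsCompact S)
    (hne : S.Nonempty) (hSd : S ⊆ dom f) (hpd : ∀ x ∈ S, (hessian (re f) x).PosDef) {η : ℝ}
    (hη : 0 ≤ η) : ∀ x ∈ S, condTerm b f η x ≤ sSup (condTerm b f η '' S) := by
  intro x hx
  refine le_csSup ?_ ⟨x, hx, rfl⟩
  obtain ⟨hσ, hσle⟩ := sigmaF_pos_and_le hN hf hS hne hSd hpd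
  have hL := hessQuad_le_LF hf hS hSd
  set σ := sigmaF f S
  set L := LF f S
  refine ⟨(1 + η) * (Real.sqrt L * (Real.sqrt σ)⁻¹) + (Real.sqrt σ)⁻¹ * Real.sqrt L, ?_⟩
  rintro _ ⟨y, hy, rfl⟩
  have hB := hpd y hy
  have hH := posDef_blkDiag b hB
  have h1 := spectralNorm_mul_le (CFC.sqrt (blkDiag b (hessian (re f) y)))
    (CFC.sqrt (hessian (re f) y))⁻¹ (Real.sqrt_nonneg L) (inv_nonneg.2 (Real.sqrt_nonneg σ))
    (norm_sqrt_le hH (inner_blkDiag_le b (hL y hy))) (norm_inv_sqrt_le hB hσ (hσle y hy))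
  have h2 := spectralNorm_mul_le (CFC.sqrt (blkDiag b (hessian (re f) y)))⁻¹
    (CFC.sqrt (hessian (re f) y)) (inv_nonneg.2 (Real.sqrt_nonneg σ)) (Real.sqrt_nonneg L)
    (norm_inv_sqrt_le hH hσ (le_inner_blkDiag b (hσle y hy))) (norm_sqrt_le hB (hL y hy))
  unfold condTerm
  gcongr

/-- The two spectral norms have product at least 1, hence sum at least 1. This is what makes c̃₄ at
most 1. -/
lemma one_le_condTerm [Nonempty (Fin N)] {x : EuclideanSpace ℝ (Fin N)}
    (hpd : (hessian (re f) x).PosDef) {η : ℝ} (hη : 0 ≤ η) : 1 ≤ condTerm b f η x := by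
  have h := one_le_spectralNorm_mul (posDef_blkDiag b hpd) hpd
  unfold condTerm
  set a := spectralNorm (CFC.sqrt (blkDiag b (hessian (re f) x)) * (CFC.sqrt (hessian (re f) x))⁻¹)
  set a' := spectralNorm
    ((CFC.sqrt (blkDiag b (hessian (re f) x)))⁻¹ * CFC.sqrt (hessian (re f) x))
  have ha : 0 ≤ a := spectralNorm_nonneg _
  have ha' : 0 ≤ a' := spectralNorm_nonneg _
  nlinarith [sq_nonneg (a - a'), mul_nonneg hη ha]

end Problem

/-! ### One step of the method -/

section Step

variable {N n : ℕ} {b : Fin N → Fin n} {f : EuclideanSpace ℝ (Fin N) → EReal}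
  {g : (i : Fin n) → Block b i → EReal}

lemma dom_of_mem_subdiff {V : Type*} [NormedAddCommGroup V] [InnerProductSpace ℝ V]
    {h : V → EReal} {y z s : V} (hz : z ∈ dom h) (hs : s ∈ subdiff h y) : y ∈ dom h := by
  intro ht
  have := hs z
  rw [ht, EReal.top_add_coe, top_le_iff] at this
  exact hz this

lemma re_le_of_mem_subdiff {V : Type*} [NormedAddCommGroup V] [InnerProductSpace ℝ V]
    {h : V → EReal} (hb : ∀ x, h x ≠ ⊥) {y z s : V} (hz : z ∈ dom h) (hs : s ∈ subdiff h y) :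
    re h y + inner ℝ s (z - y) ≤ re h z := by
  have := hs z
  rw [← coe_re hb hz, ← coe_re hb (dom_of_mem_subdiff hz hs)] at this
  exact_mod_cast this

lemma gSum_add_embBlk (hg : ∀ i, IsProperClosedConvex (g i)) {x : EuclideanSpace ℝ (Fin N)}
    (hx : x ∈ dom (gSum b g)) {i : Fin n} {e : Block b i} (he : blk b i x + e ∈ dom (g i)) :
    x + embBlk b i e ∈ dom (gSum b g) ∧
      re (gSum b g) (x + embBlk b i e)
        = re (gSum b g) x + (re (g i) (blk b i x + e) - re (g i) (blk b i x)) := by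
  have hne : ∀ k, k ≠ i → blk b k (x + embBlk b i e) = blk b k x := fun k hk => by
    rw [blk_add, blk_embBlk_ne b hk, add_zero]
  have hsame : blk b i (x + embBlk b i e) = blk b i x + e := by
    rw [blk_add, blk_embBlk_same]
  have hd : x + embBlk b i e ∈ dom (gSum b g) := by
    rw [mem_dom_gSum hg] at hx ⊢
    intro k
    by_cases hk : k = i
    · subst hk
      rwa [hsame]
    · rw [hne k hk]
      exact hx k
  refine ⟨hd, ?_⟩
  rw [re_gSum hg hd, re_gSum hg hx, ← Finset.add_sum_erase _ _ (Finset.mem_univ i),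
    ← Finset.add_sum_erase _ (fun i => re (g i) (blk b i x)) (Finset.mem_univ i), hsame]
  have : ∑ k ∈ Finset.univ.erase i, re (g k) (blk b k (x + embBlk b i e))
      = ∑ k ∈ Finset.univ.erase i, re (g k) (blk b k x) :=
    Finset.sum_congr rfl fun k hk => by rw [hne k (Finset.ne_of_mem_erase hk)]
  rw [this]
  ring

/-- Solve the optimality condition for s and pair it with d: the Hessian term contributes -λ², and
Cauchy-Schwarz bounds the residual by ηλ². -/
lemma inner_subgradient_le {x : EuclideanSpace ℝ (Fin N)} {i : Fin n} {η : ℝ}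
    {d v s : Block b i} (hpd : (hessian (re f) x).PosDef)
    (hv : -v = blk b i (gradient (re f) x)
      + Matrix.toEuclideanLin (diagBlk b i (hessian (re f) x)) d + s)
    (hvn : weightedNorm (diagBlk b i (hessian (re f) x))⁻¹ v ≤
      η * weightedNorm (diagBlk b i (hessian (re f) x)) d) :
    inner ℝ s d ≤ -inner ℝ (gradient (re f) x) (embBlk b i d)
      - (1 - η) * weightedNorm (diagBlk b i (hessian (re f) x)) d ^ 2 := by
  have hH := posDef_diagBlk b hpd i
  set lam := weightedNorm (diagBlk b i (hessian (re f) x)) d with hlam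
  have h0 : 0 ≤ lam := weightedNorm_nonneg _ _
  have e : s = -v - blk b i (gradient (re f) x)
      - Matrix.toEuclideanLin (diagBlk b i (hessian (re f) x)) d := by
    rw [hv]; abel
  have h1 := (abs_le.1 (abs_inner_le_weightedNorm hH v d)).1
  have h2 := mul_le_mul_of_nonneg_right hvn h0
  have h3 := weightedNorm_sq hH d
  rw [real_inner_comm] at h3
  rw [← hlam] at h1 h3
  rw [e, inner_sub_left, inner_sub_left, inner_neg_left, ← h3, inner_embBlk]
  nlinarith

lemma hessQuad_embBlk {x : EuclideanSpace ℝ (Fin N)} (hpd : (hessian (re f) x).PosDef)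
    (i : Fin n) (d : Block b i) :
    hessQuad f x (embBlk b i d) = weightedNorm (diagBlk b i (hessian (re f) x)) d ^ 2 := by
  rw [weightedNorm_sq (posDef_diagBlk b hpd i), inner_diagBlk, hessQuad]

lemma hessQuad_smul (x u : EuclideanSpace ℝ (Fin N)) (c : ℝ) :
    hessQuad f x (c • u) = c ^ 2 * hessQuad f x u := by
  rw [hessQuad, map_smul, inner_smul_left, inner_smul_right, hessQuad]
  simp only [RCLike.conj_to_real]
  ring

/-- The decrease of the objective in one damped Newton step. -/
lemma step_decrease (hprob : IsCompositeSCProblem b f g) {x : EuclideanSpace ℝ (Fin N)}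
    (hx : x ∈ dom (objective b f g)) {η : ℝ} (hη : η ∈ Icc (0 : ℝ) (1 / 4)) {i : Fin n}
    {d : Block b i} (hd : IsInexactDirection b f g η x i d) {lam : ℝ}
    (hlam : lam = weightedNorm (diagBlk b i (hessian (re f) x)) d) :
    addBlk b i x ((1 + lam)⁻¹ • d) ∈ dom (objective b f g) ∧
      re (objective b f g) (addBlk b i x ((1 + lam)⁻¹ • d)) ≤
        re (objective b f g) x - lam ^ 2 / (4 * (1 + lam)) := by
  have hpd := hprob.posDef x hx
  have hgc := hprob.properClosedConvex
  obtain ⟨hxf, hxg⟩ := hprob.mem_dom.1 hx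
  have hxi := (mem_dom_gSum hgc).1 hxg i
  have hl0 : 0 ≤ lam := hlam ▸ weightedNorm_nonneg _ _
  -- A zero direction is treated apart because the upper bound for f needs strict positivity of the
  -- Hessian along the step.
  by_cases hd0 : d = 0
  · have : lam = 0 := by rw [hlam, hd0]; simp [weightedNorm]
    rw [addBlk_eq, hd0, smul_zero, map_zero, add_zero, this]
    exact ⟨hx, by simp⟩
  obtain ⟨v, ⟨s, hs, hv⟩, hvn⟩ := hd
  have hsd := inner_subgradient_le hpd hv hvn
  rw [← hlam] at hsd
  have hyd : blk b i x + d ∈ dom (g i) := dom_of_mem_subdiff hxi hs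
  have h1l : 0 < 1 + lam := by linarith
  set c := (1 + lam)⁻¹ with hc
  have hc0 : 0 < c := inv_pos.2 h1l
  have hc1 : c ≤ 1 := inv_le_one_of_one_le₀ (by linarith)
  have hseg : ∀ t ∈ Icc (0 : ℝ) 1, blk b i x + t • d ∈ dom (g i) ∧
      re (g i) (blk b i x + t • d) ≤ (1 - t) * re (g i) (blk b i x)
        + t * re (g i) (blk b i x + d) := by
    intro t ht
    have e : blk b i x + t • d = (1 - t) • blk b i x + t • (blk b i x + d) := by module
    rw [e]
    exact ⟨(hgc i).convex.1 hxi hyd (by linarith [ht.2]) ht.1 (by ring),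
      (hgc i).convex.2 hxi hyd (by linarith [ht.2]) ht.1 (by ring)⟩
  set u := embBlk b i (c • d) with hu
  have hu0 : u ≠ 0 := by
    intro h
    have : ‖u‖ = 0 := by rw [h, norm_zero]
    rw [hu, norm_embBlk, norm_smul, mul_eq_zero, norm_eq_zero, norm_eq_zero] at this
    exact this.elim hc0.ne' hd0
  have hhu : hessQuad f x u = (c * lam) ^ 2 := by
    rw [hu, map_smul, hessQuad_smul, hessQuad_embBlk hpd, ← hlam]; ring
  have hsq : Real.sqrt (hessQuad f x u) = c * lam := by
    rw [hhu, Real.sqrt_sq (by positivity)]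
  have hcl : c * lam < 1 := by
    rw [hc, inv_mul_lt_iff₀ h1l]; linarith
  -- Positive definiteness is known only on the domain of F; convexity of g_i keeps the segment in
  -- the domain of g, so finiteness of f is enough.
  have hup := hprob.selfConcordant.upper (x := x) (u := u) hxf (fun t ht htd => by
    have hg' : x + t • u ∈ dom (gSum b g) := by
      rw [hu, ← map_smul, smul_smul]
      exact (gSum_add_embBlk hgc hxg (hseg (t * c) ⟨mul_nonneg ht.1 hc0.le,
        mul_le_one₀ ht.2 hc0.le hc1⟩).1).1
    exact posDef_inner_pos (hprob.posDef _ (hprob.mem_dom.2 ⟨htd, hg'⟩)) hu0) (by rwa [hsq])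
  rw [hsq] at hup
  have hsegc := hseg c ⟨hc0.le, hc1⟩
  obtain ⟨hgd, hge⟩ := gSum_add_embBlk hgc hxg hsegc.1
  rw [addBlk_eq, ← hu]
  rw [← hu] at hgd hge
  have hxd : x + u ∈ dom (objective b f g) := hprob.mem_dom.2 ⟨hup.1, hgd⟩
  refine ⟨hxd, ?_⟩
  rw [hprob.re_eq hxd, hprob.re_eq hx, hge]
  have hsub := re_le_of_mem_subdiff (hgc i).ne_bot hxi hs
  have e1 : blk b i x - (blk b i x + d) = -d := by abel
  rw [e1, inner_neg_right] at hsub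
  -- Damping by 1/(1+λ) turns 1 - λ/(1+λ) into 1/(1+λ), so ω_* becomes a logarithm of 1+λ.
  have hω : omegaStar (c * lam) = -(c * lam) + Real.log (1 + lam) := by
    have : 1 - c * lam = (1 + lam)⁻¹ := by rw [hc]; field_simp; ring
    rw [omegaStar, this, Real.log_inv]; ring
  have hlog := log_one_add_le hl0
  have hgu : inner ℝ (gradient (re f) x) u
      = c * inner ℝ (gradient (re f) x) (embBlk b i d) := by
    rw [hu, map_smul, inner_smul_right]
  rw [hω, hgu] at hup
  have h3 := hup.2
  have h4 := hsegc.2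
  set G := inner ℝ (gradient (re f) x) (embBlk b i d)
  have h5 : c * (re (g i) (blk b i x + d) - re (g i) (blk b i x))
      ≤ c * (-G - (1 - η) * lam ^ 2) :=
    mul_le_mul_of_nonneg_left (by linarith) hc0.le
  -- The left side equals -(1-2η)λ²/(2(1+λ)); the condition η ≤ 1/4 yields the constant 4.
  have h6 : c * (-((1 - η) * lam ^ 2)) - c * lam + (lam - lam ^ 2 / (2 * (1 + lam)))
      ≤ -(lam ^ 2 / (4 * (1 + lam))) := by
    have e : c * (-((1 - η) * lam ^ 2)) - c * lam + (lam - lam ^ 2 / (2 * (1 + lam)))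
        = -((1 - 2 * η) * lam ^ 2 / (2 * (1 + lam))) := by
      rw [hc]; field_simp; ring
    rw [e, neg_le_neg_iff, div_le_div_iff₀ (by positivity) (by positivity)]
    have : 0 ≤ lam ^ 2 * (1 + lam) * (1 / 4 - η) := by
      have := hη.2
      have : 0 ≤ 1 / 4 - η := by linarith
      positivity
    nlinarith
  nlinarith

lemma inner_gradient_sub_le (hf : IsSelfConcordant 2 f) {x D : EuclideanSpace ℝ (Fin N)} {L τ : ℝ}
    (hτ : 0 ≤ τ) (hd : ∀ t ∈ Icc 0 τ, x + t • D ∈ dom f)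
    (hL : ∀ t ∈ Icc 0 τ, hessQuad f (x + t • D) D ≤ L * ‖D‖ ^ 2) :
    inner ℝ (gradient (re f) (x + τ • D)) D - inner ℝ (gradient (re f) x) D
      ≤ L * τ * ‖D‖ ^ 2 := by
  have := le_of_hasDerivAt_nonneg hτ
    (A := fun t => t * (L * ‖D‖ ^ 2) - inner ℝ (gradient (re f) (x + t • D)) D)
    (A1 := fun t => L * ‖D‖ ^ 2 - hessQuad f (x + t • D) D)
    (fun t ht => by
      have h1 : HasDerivAt (fun t => t * (L * ‖D‖ ^ 2)) (L * ‖D‖ ^ 2) t := by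
        simpa using (hasDerivAt_id t).mul_const (L * ‖D‖ ^ 2)
      exact h1.sub (hf.hasDerivAt_two (hd t ht)))
    (fun t ht => sub_nonneg.2 (hL t ht))
  simp only [zero_mul, zero_smul, add_zero, zero_sub] at this
  linarith

lemma hasDerivAt_nonneg_of_right_le {A : ℝ → ℝ} {a τ : ℝ} (h : HasDerivAt A a τ)
    (hge : ∀ᶠ t in nhdsWithin τ (Ioi τ), A τ ≤ A t) : 0 ≤ a := by
  have hsub : Ioi τ ⊆ {τ}ᶜ := fun t ht => (mem_Ioi.1 ht).ne'
  have h1 := (hasDerivAt_iff_tendsto_slope.1 h).mono_left (nhdsWithin_mono τ hsub)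
  refine ge_of_tendsto h1 ?_
  filter_upwards [hge, self_mem_nhdsWithin] with t ht ht'
  rw [slope_def_field]
  exact div_nonneg (sub_nonneg.2 ht) (sub_nonneg.2 (le_of_lt ht'))

/-- The linearization error of `g_i` over an inexact direction is at most quadratic. -/
lemma linearization_error_le (hprob : IsCompositeSCProblem b f g)
    {x0 : EuclideanSpace ℝ (Fin N)} (hx0 : x0 ∈ dom (objective b f g)) {Lg : ℝ} (hLg : 0 ≤ Lg)
    (hg : IsLipschitzDifferentiableOn Lg (gSum b g) (sublevel (objective b f g) x0)) {L : ℝ}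
    (hL0 : 0 ≤ L)
    (hL : ∀ y ∈ sublevel (objective b f g) x0, ∀ u, hessQuad f y u ≤ L * ‖u‖ ^ 2)
    {x : EuclideanSpace ℝ (Fin N)} (hx : x ∈ sublevel (objective b f g) x0) {η : ℝ} (hη : η ≤ 1)
    {i : Fin n} {d v s : Block b i} (hs : s ∈ subdiff (g i) (blk b i x + d))
    (hv : -v = blk b i (gradient (re f) x)
      + Matrix.toEuclideanLin (diagBlk b i (hessian (re f) x)) d + s)
    (hvn : weightedNorm (diagBlk b i (hessian (re f) x))⁻¹ v ≤
      η * weightedNorm (diagBlk b i (hessian (re f) x)) d) :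
    re (g i) (blk b i x) - re (g i) (blk b i x + d) + inner ℝ s d ≤ (L + Lg) * ‖d‖ ^ 2 := by
  set S := sublevel (objective b f g) x0 with hS
  have hgc := hprob.properClosedConvex
  have hxd := ((hprob.mem_sublevel hx0).1 hx).1
  have hpd := hprob.posDef x hxd
  obtain ⟨hxf, hxg⟩ := hprob.mem_dom.1 hxd
  have hxi := (mem_dom_gSum hgc).1 hxg i
  have hyd : blk b i x + d ∈ dom (g i) := dom_of_mem_subdiff hxi hs
  have hsd := inner_subgradient_le hpd hv hvn
  obtain ⟨hDd, hDe⟩ := gSum_add_embBlk hgc hxg hyd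
  set D := embBlk b i d with hD
  have hDn : ‖D‖ = ‖d‖ := norm_embBlk b i d
  have hSf : S ⊆ dom f := fun y hy => (hprob.mem_dom.1 ((hprob.mem_sublevel hx0).1 hy).1).1
  have hθ : ∀ t : ℝ, x + t • D ∈ S → HasDerivAt (fun t : ℝ => re (gSum b g) (x + t • D))
      (inner ℝ (gradient (re (gSum b g)) (x + t • D)) D) t := fun t ht =>
    hasDerivAt_comp_line (hg.differentiableAt _ ht)
  have hx00 : x + (0 : ℝ) • D ∈ S := by simpa using hx
  have hconv : ConvexOn ℝ (Icc (0 : ℝ) 1) fun t : ℝ => re (gSum b g) (x + t • D) := by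
    have e : ∀ t : ℝ, x + t • D = (1 - t) • x + t • (x + D) := fun t => by module
    have hmem : ∀ t ∈ Icc (0 : ℝ) 1, x + t • D ∈ dom (gSum b g) := fun t ht => by
      rw [e]
      exact hprob.convexOn_gSum.1 hxg hDd (by linarith [ht.2]) ht.1 (by ring)
    refine ⟨convex_Icc 0 1, fun t ht r hr α β hα hβ hαβ => ?_⟩
    have e2 : x + (α • t + β • r) • D = α • (x + t • D) + β • (x + r • D) := by
      have : β = 1 - α := by linarith
      subst this
      simp only [smul_eq_mul]
      module
    beta_reduce
    rw [e2]
    exact hprob.convexOn_gSum.2 (hmem t ht) (hmem r hr) hα hβ hαβ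
  have hgrad : re (gSum b g) x + inner ℝ (gradient (re (gSum b g)) x) D
      ≤ re (gSum b g) (x + D) := by
    have := hconv.le_slope_of_hasDerivAt (left_mem_Icc.2 zero_le_one)
      (right_mem_Icc.2 zero_le_one) zero_lt_one (hθ 0 hx00)
    rw [slope_def_field] at this
    simp only [zero_smul, add_zero, one_smul, sub_zero, div_one] at this
    linarith
  have hbreg : re (g i) (blk b i x) - re (g i) (blk b i x + d)
      ≤ -inner ℝ (gradient (re (gSum b g)) x) D := by
    linarith
  have hlip : ∀ t : ℝ, 0 ≤ t → t ≤ 1 → x + t • D ∈ S →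
      inner ℝ (gradient (re (gSum b g)) (x + t • D)) D - inner ℝ (gradient (re (gSum b g)) x) D
        ≤ Lg * ‖d‖ ^ 2 := by
    intro t ht0 ht1 htS
    rw [← inner_sub_left]
    have h1 := hg.lipschitz _ htS _ hx
    rw [add_sub_cancel_left, norm_smul, Real.norm_eq_abs, abs_of_nonneg ht0, hDn] at h1
    calc _ ≤ ‖gradient (re (gSum b g)) (x + t • D) - gradient (re (gSum b g)) x‖ * ‖D‖ :=
          real_inner_le_norm _ _
      _ ≤ (Lg * (t * ‖d‖)) * ‖d‖ := by rw [hDn]; gcongr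
      _ = Lg * ‖d‖ ^ 2 * t := by ring
      _ ≤ Lg * ‖d‖ ^ 2 := mul_le_of_le_one_right (by positivity) ht1
  have hopen : ∀ t : ℝ, x + t • D ∈ S → ∀ᶠ r in nhds t, x + r • D ∈ dom (gSum b g) := by
    intro t ht
    have := eventually_line_mem isOpen_interior (hg.subset_interior_dom ht)
    exact this.mono fun r hr => interior_subset hr
  by_cases hxS : x + D ∈ S
  · have h1S : x + (1 : ℝ) • D ∈ S := by simpa using hxS
    -- As s is a subgradient at x_i + d, t = 1 minimizes g(x+tD) - t⟨s,d⟩ locally; differentiability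
    -- then gives ⟨s,d⟩ = ⟨∇g(x+D),D⟩ and the Lipschitz bound finishes this case.
    have hmin : IsLocalMin (fun t : ℝ => re (gSum b g) (x + t • D) - t * inner ℝ s d) 1 := by
      filter_upwards [hopen 1 h1S] with t ht
      have hti : blk b i x + t • d ∈ dom (g i) := by
        have := (mem_dom_gSum hgc).1 ht i
        rwa [blk_add, blk_smul, hD, blk_embBlk_same] at this
      have h2 := (gSum_add_embBlk hgc hxg hti).2
      rw [map_smul, ← hD] at h2
      have h3 := re_le_of_mem_subdiff (hgc i).ne_bot hti hs
      have e : blk b i x + t • d - (blk b i x + d) = (t - 1) • d := by module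
      rw [e, inner_smul_right] at h3
      rw [h2, one_smul, hDe]
      linarith
    have hder : HasDerivAt (fun t : ℝ => re (gSum b g) (x + t • D) - t * inner ℝ s d)
        (inner ℝ (gradient (re (gSum b g)) (x + (1 : ℝ) • D)) D - inner ℝ s d) 1 := by
      have h1 : HasDerivAt (fun t : ℝ => t * (inner ℝ s d : ℝ)) (inner ℝ s d) 1 := by
        simpa using (hasDerivAt_id (1 : ℝ)).mul_const (inner ℝ s d : ℝ)
      exact (hθ 1 h1S).sub h1
    have h0 := hmin.hasDerivAt_eq_zero hder
    have h4 := hlip 1 zero_le_one le_rfl h1S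
    have : 0 ≤ L * ‖d‖ ^ 2 := by positivity
    linarith
  -- Here x + D lies outside S, so ∇g is not controlled there. Let τ be the last time the segment is
  -- in S.
  · set Tt : Set ℝ := Icc 0 1 ∩ {t | x + t • D ∈ S} with hTt
    have hcont : Continuous fun t : ℝ => x + t • D := by fun_prop
    have hcomp : IsCompact Tt :=
      isCompact_Icc.inter_right ((hprob.isClosed_sublevel x0).preimage hcont)
    obtain ⟨τ, hτ, hτmax⟩ := hcomp.exists_isGreatest ⟨0, ⟨le_rfl, zero_le_one⟩, hx00⟩
    have hτ1 : τ < 1 := by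
      rcases hτ.1.2.lt_or_eq with h | h
      · exact h
      · exfalso
        apply hxS
        have := hτ.2
        rw [h] at this
        simpa using this
    have hseg : ∀ t ∈ Icc 0 τ, x + t • D ∈ S := by
      intro t ht
      rcases hτ.1.1.lt_or_eq with h | h
      · have e : x + t • D = x + (t / τ) • ((x + τ • D) - x) := by
          rw [add_sub_cancel_left, smul_smul, div_mul_cancel₀ _ h.ne']
        rw [e]
        exact (hprob.convex_sublevel hx0).add_smul_sub_mem hx hτ.2
          ⟨div_nonneg ht.1 h.le, div_le_one_of_le₀ ht.2 h.le⟩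
      · have : t = 0 := le_antisymm (h ▸ ht.2) ht.1
        rw [this]
        exact hx00
    have hsum : HasDerivAt (fun t : ℝ => re f (x + t • D) + re (gSum b g) (x + t • D))
        (inner ℝ (gradient (re f) (x + τ • D)) D
          + inner ℝ (gradient (re (gSum b g)) (x + τ • D)) D) τ :=
      (hprob.selfConcordant.hasDerivAt_one (hSf hτ.2)).add (hθ τ hτ.2)
    -- Just after τ the value of F exceeds F(x⁰) ≥ F(x+τD), so its directional derivative at τ is
    -- nonnegative. This bounds -⟨∇g,D⟩ by ⟨∇f,D⟩ at τ; transported back to x at cost (L+L_g)‖d‖²,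
    -- the term ⟨∇f(x),D⟩ cancels against the bound on ⟨s,d⟩.
    have hnonneg := hasDerivAt_nonneg_of_right_le hsum (by
      filter_upwards [self_mem_nhdsWithin, nhdsWithin_le_nhds (hopen τ hτ.2),
        nhdsWithin_le_nhds (eventually_line_mem hprob.selfConcordant.isOpen_dom (hSf hτ.2)),
        nhdsWithin_le_nhds (Iio_mem_nhds hτ1)] with t ht htg htf ht1
      have htd : x + t • D ∈ dom (objective b f g) := hprob.mem_dom.2 ⟨htf, htg⟩
      have hnot : x + t • D ∉ S := fun h => by
        have := hτmax ⟨⟨hτ.1.1.trans (le_of_lt ht), le_of_lt ht1⟩, h⟩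
        exact absurd this (not_le.2 ht)
      have hτd2 := (hprob.mem_sublevel hx0).1 hτ.2
      have hlt : re (objective b f g) x0 < re (objective b f g) (x + t • D) := by
        by_contra! hle
        exact hnot ((hprob.mem_sublevel hx0).2 ⟨htd, hle⟩)
      have := hτd2.2.trans hlt.le
      rwa [hprob.re_eq htd, hprob.re_eq hτd2.1] at this)
    have h1 := inner_gradient_sub_le hprob.selfConcordant hτ.1.1
      (fun t ht => hSf (hseg t ht)) (fun t ht => hL _ (hseg t ht) D)
    have h2 := hlip τ hτ.1.1 hτ1.le hτ.2
    have h3 : L * τ * ‖D‖ ^ 2 ≤ L * ‖d‖ ^ 2 := by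
      rw [hDn]
      have : L * τ ≤ L := mul_le_of_le_one_right hL0 hτ1.le
      gcongr
    have h4 : 0 ≤ (1 - η) * weightedNorm (diagBlk b i (hessian (re f) x)) d ^ 2 :=
      mul_nonneg (by linarith) (sq_nonneg _)
    linarith

/-- The optimality gap is controlled by the length of the block directions. -/
lemma gap_le (hprob : IsCompositeSCProblem b f g)
    {x0 : EuclideanSpace ℝ (Fin N)} (hx0 : x0 ∈ dom (objective b f g)) {Lg : ℝ} (hLg : 0 ≤ Lg)
    (hg : IsLipschitzDifferentiableOn Lg (gSum b g) (sublevel (objective b f g) x0)) {σ L : ℝ}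
    (hL0 : 0 ≤ L) (hσ : 0 < σ)
    (hL : ∀ y ∈ sublevel (objective b f g) x0, ∀ u, hessQuad f y u ≤ L * ‖u‖ ^ 2)
    (hσL : ∀ y ∈ sublevel (objective b f g) x0, ∀ u, σ * ‖u‖ ^ 2 ≤ hessQuad f y u)
    {x z : EuclideanSpace ℝ (Fin N)} (hx : x ∈ sublevel (objective b f g) x0)
    (hz : z ∈ dom (objective b f g)) {η : ℝ} (hη0 : 0 ≤ η) (hη : η ≤ 1)
    {d : ∀ i, Block b i} (hd : ∀ i, IsInexactDirection b f g η x i (d i)) {Λ r : ℝ}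
    (hΛ : Λ = Real.sqrt (∑ i, weightedNorm (diagBlk b i (hessian (re f) x)) (d i) ^ 2))
    (hr : r = Real.sqrt (hessQuad f x (z - x))) :
    re (objective b f g) x - re (objective b f g) z ≤ (L + Lg) / σ * Λ ^ 2
      + (1 + η) * Λ * spectralNorm (CFC.sqrt (blkDiag b (hessian (re f) x))
          * (CFC.sqrt (hessian (re f) x))⁻¹) * r - (r - Real.log (1 + r)) := by
  have hgc := hprob.properClosedConvex
  have hxd := ((hprob.mem_sublevel hx0).1 hx).1
  have hpd := hprob.posDef x hxd
  obtain ⟨hxf, hxg⟩ := hprob.mem_dom.1 hxd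
  obtain ⟨hzf, hzg⟩ := hprob.mem_dom.1 hz
  choose v hv hvn using hd
  choose s hs hvs using hv
  set B := hessian (re f) x with hB
  set lam : Fin n → ℝ := fun i => weightedNorm (diagBlk b i B) (d i) with hlam
  set y := z - x with hy
  have hsumnn : 0 ≤ ∑ i, lam i ^ 2 := Finset.sum_nonneg fun i _ => sq_nonneg _
  have hΛ2 : Λ ^ 2 = ∑ i, lam i ^ 2 := by rw [hΛ, Real.sq_sqrt hsumnn]
  have hΛ0 : 0 ≤ Λ := by rw [hΛ]; exact Real.sqrt_nonneg _
  -- the smooth part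
  have hfl : re f x + inner ℝ (gradient (re f) x) y + (r - Real.log (1 + r)) ≤ re f z := by
    have hxz : x + y = z := by rw [hy]; abel
    by_cases hy0 : y = 0
    · have hr0 : r = 0 := by rw [hr, hy0]; simp [hessQuad]
      have : x = z := by rw [← hxz, hy0, add_zero]
      rw [hr0, hy0, this]
      simp
    have hseg : ∀ t ∈ Icc (0 : ℝ) 1, x + t • y ∈ dom (objective b f g) := fun t ht =>
      hprob.convexOn.1.add_smul_sub_mem hxd hz ht
    have := hprob.selfConcordant.lower (x := x) (u := y)
      (fun t ht => (hprob.mem_dom.1 (hseg t ht)).1)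
      (fun t ht => posDef_inner_pos (hprob.posDef _ (hseg t ht)) hy0)
    rwa [← hr, hxz] at this
  -- the nonsmooth part
  have hgl : re (gSum b g) x - re (gSum b g) z
      ≤ (L + Lg) * ∑ i, ‖d i‖ ^ 2 - ∑ i, inner ℝ (s i) (blk b i y) := by
    rw [re_gSum hgc hxg, re_gSum hgc hzg, Finset.mul_sum, ← Finset.sum_sub_distrib,
      ← Finset.sum_sub_distrib]
    refine Finset.sum_le_sum fun i _ => ?_
    have h1 := linearization_error_le hprob hx0 hLg hg hL0 hL hx hη (hs i) (hvs i) (hvn i)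
    -- Comparing g_i at x_i + d_i with g_i at z_i leaves the linearization error plus -⟨s_i, z_i -
    -- x_i⟩.
    have h2 := re_le_of_mem_subdiff (hgc i).ne_bot ((mem_dom_gSum hgc).1 hzg i) (hs i)
    have e : blk b i z - (blk b i x + d i) = blk b i y - d i := by rw [hy, blk_sub]; abel
    rw [e, inner_sub_right] at h2
    linarith
  -- The block optimality conditions stacked into one vector identity; the ∇f term cancels the one
  -- in the lower bound for f.
  have hsn : -∑ i, inner ℝ (s i) (blk b i y) = inner ℝ (gradient (re f) x) y
      + inner ℝ (ofBlks b v + Matrix.toEuclideanLin (blkDiag b B) (ofBlks b d)) y := by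
    rw [← inner_add_left, inner_eq_sum_blk b, ← Finset.sum_neg_distrib]
    refine Finset.sum_congr rfl fun i _ => ?_
    rw [← inner_neg_left, blk_add, blk_add, blk_ofBlks, blk_blkDiag, blk_ofBlks]
    congr 1
    rw [neg_eq_iff_add_eq_zero]
    have := hvs i
    rw [neg_eq_iff_add_eq_zero] at this
    rw [← this]
    abel
  have hH := posDef_blkDiag b hpd
  have hin := inner_add_le_of_two_metrics hH hpd (ofBlks b v) (ofBlks b d) y
  have hwd : weightedNorm (blkDiag b B) (ofBlks b d) = Λ := by
    rw [weightedNorm_blkDiag b hpd, hΛ]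
    simp only [blk_ofBlks]
  have hwv : weightedNorm (blkDiag b B)⁻¹ (ofBlks b v) ≤ η * Λ := by
    rw [weightedNorm_blkDiag_inv b hpd]
    refine Real.sqrt_le_iff.2 ⟨by positivity, ?_⟩
    rw [mul_pow, hΛ2, Finset.mul_sum]
    refine Finset.sum_le_sum fun i _ => ?_
    rw [blk_ofBlks, ← mul_pow]
    have := hvn i
    have h0 := weightedNorm_nonneg (diagBlk b i B)⁻¹ (v i)
    gcongr
  have hwy : weightedNorm B y = r := by rw [hr]; rfl
  have hr0 : 0 ≤ r := by rw [hr]; exact Real.sqrt_nonneg _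
  set a := spectralNorm (CFC.sqrt (blkDiag b B) * (CFC.sqrt B)⁻¹) with ha
  have ha0 : 0 ≤ a := spectralNorm_nonneg _
  have hin2 : inner ℝ (ofBlks b v + Matrix.toEuclideanLin (blkDiag b B) (ofBlks b d)) y
      ≤ (1 + η) * Λ * a * r := by
    rw [hwd, hwy] at hin
    refine hin.trans ?_
    calc _ ≤ a * (η * Λ + Λ) * r := by gcongr
      _ = _ := by ring
  have hdn : (L + Lg) * ∑ i, ‖d i‖ ^ 2 ≤ (L + Lg) / σ * Λ ^ 2 := by
    rw [div_mul_eq_mul_div, le_div_iff₀ hσ, mul_assoc, hΛ2]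
    gcongr
    rw [Finset.sum_mul]
    refine Finset.sum_le_sum fun i _ => ?_
    have := hσL x hx (embBlk b i (d i))
    rw [norm_embBlk, hessQuad_embBlk hpd] at this
    linarith
  rw [hprob.re_eq hxd, hprob.re_eq hz]
  linarith

/-- Expected one-step contraction. -/
lemma expected_decrease (hN : 0 < N) (hprob : IsCompositeSCProblem b f g)
    {x0 : EuclideanSpace ℝ (Fin N)} (hx0 : x0 ∈ dom (objective b f g)) {Lg : ℝ} (hLg : 0 ≤ Lg)
    (hg : IsLipschitzDifferentiableOn Lg (gSum b g) (sublevel (objective b f g) x0))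
    {σ L M c P : ℝ} (hσ : 0 < σ)
    (hL : ∀ y ∈ sublevel (objective b f g) x0, ∀ u, hessQuad f y u ≤ L * ‖u‖ ^ 2)
    (hσL : ∀ y ∈ sublevel (objective b f g) x0, ∀ u, σ * ‖u‖ ^ 2 ≤ hessQuad f y u)
    {η : ℝ} (hη : η ∈ Icc (0 : ℝ) (1 / 4))
    (hM : ∀ y ∈ sublevel (objective b f g) x0, condTerm b f η y ≤ M)
    (hc : c = σ / (M * (L + Lg)))
    {p : Fin n → ℝ} (hp : ∀ i, 0 < p i) (hps : ∑ i, p i = 1) (hP : 0 < P) (hPp : ∀ i, P ≤ p i)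
    {z : EuclideanSpace ℝ (Fin N)} (hz : ∀ y, objective b f g z ≤ objective b f g y)
    {x : EuclideanSpace ℝ (Fin N)} (hx : x ∈ sublevel (objective b f g) x0)
    {x' : Fin n → EuclideanSpace ℝ (Fin N)} (hstep : ∀ i, IsStep b f g η x i (x' i)) :
    ∑ i, p i * (re (objective b f g) (x' i) - re (objective b f g) z)
      ≤ rate c P (re (objective b f g) x0 - re (objective b f g) z)
        * (re (objective b f g) x - re (objective b f g) z) := by
  have : Nonempty (Fin N) := ⟨⟨0, hN⟩⟩
  have hxd := (hprob.mem_sublevel hx0).1 hx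
  have hpd := hprob.posDef x hxd.1
  have hzd : z ∈ dom (objective b f g) := ((hprob.mem_sublevel hx0).1 (hz x0)).1
  have hle : ∀ y ∈ dom (objective b f g), re (objective b f g) z ≤ re (objective b f g) y :=
    fun y hy => ((hprob.mem_sublevel hy).1 (hz y)).2
  choose d hd hx' using hstep
  set lam : Fin n → ℝ := fun i => weightedNorm (diagBlk b i (hessian (re f) x)) (d i) with hlam
  have hl0 : ∀ i, 0 ≤ lam i := fun i => weightedNorm_nonneg _ _
  set Λ := Real.sqrt (∑ i, lam i ^ 2) with hΛ
  have hΛ0 : 0 ≤ Λ := Real.sqrt_nonneg _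
  have hσleL : σ ≤ L := by
    have h1 := hL x hx (EuclideanSpace.single ⟨0, hN⟩ 1)
    have h2 := hσL x hx (EuclideanSpace.single ⟨0, hN⟩ 1)
    simp at h1 h2
    linarith
  have hL0 : 0 < L := hσ.trans_le hσleL
  have hM1 : 1 ≤ M := (one_le_condTerm hpd hη.1).trans (hM x hx)
  set K := (L + Lg) / σ with hK
  have hK1 : 1 ≤ K := by rw [hK, one_le_div hσ]; linarith
  have hKM : 0 < K * M := by positivity
  have hcK : c = (K * M)⁻¹ := by
    rw [hc, hK]; field_simp
  have hc0 : 0 < c := by rw [hcK]; positivity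
  set δ := re (objective b f g) x - re (objective b f g) z with hδ
  have hδ0 : 0 ≤ δ := sub_nonneg.2 (hle x hxd.1)
  have hgap := gap_le hprob hx0 hLg hg hL0.le hσ hL hσL hx hzd hη.1
    (by linarith [hη.2]) hd hΛ rfl
  have hcw : c * omegaStarInv δ ≤ Λ := by
    rw [hcK, inv_mul_le_iff₀ hKM]
    -- If KMΛ ≥ 1 the claim is immediate, since ω_*⁻¹ takes values below 1.
    by_cases hT : K * M * Λ < 1
    · have h1 := gap_le_omegaStar hK1 hΛ0 hη.1 (spectralNorm_nonneg _) (spectralNorm_nonneg _)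
        (one_le_spectralNorm_mul (posDef_blkDiag b hpd) hpd) (hM x hx) (Real.sqrt_nonneg _)
        hgap hT
      have hTm : K * M * Λ ∈ Ico (0 : ℝ) 1 := ⟨by positivity, hT⟩
      rw [← omegaStar_strictMonoOn.le_iff_le (omegaStarInv_mem hδ0) hTm,
        omegaStar_omegaStarInv hδ0]
      exact h1
    · exact (omegaStarInv_mem hδ0).2.le.trans (not_lt.1 hT)
  have hdec := decrease_ge hc0 hP hδ0 (sub_le_sub_right hxd.2 _) hcw
  have havg := sum_mul_sq_div_ge hp hps hl0 hP hPp
  rw [← hΛ] at havg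
  have hstepdec : ∀ i, re (objective b f g) (x' i) - re (objective b f g) z
      ≤ δ - lam i ^ 2 / (1 + lam i) / 4 := by
    intro i
    have h := (step_decrease hprob hxd.1 hη (hd i) rfl).2
    rw [hx' i]
    have e : lam i ^ 2 / (1 + lam i) / 4 = lam i ^ 2 / (4 * (1 + lam i)) := by
      rw [div_div, mul_comm 4]
    rw [e, hδ]
    linarith
  calc ∑ i, p i * (re (objective b f g) (x' i) - re (objective b f g) z)
      ≤ ∑ i, p i * (δ - lam i ^ 2 / (1 + lam i) / 4) :=
        Finset.sum_le_sum fun i _ => mul_le_mul_of_nonneg_left (hstepdec i) (hp i).le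
    _ = δ - (∑ i, p i * (lam i ^ 2 / (1 + lam i))) / 4 := by
        simp only [mul_sub, Finset.sum_sub_distrib, ← Finset.sum_mul, hps, one_mul,
          Finset.sum_div, mul_div_assoc]
    _ ≤ _ := by
        have e : (P * Λ) ^ 2 / (4 * (1 + P * Λ)) = (P * Λ) ^ 2 / (1 + P * Λ) / 4 := by
          rw [div_div, mul_comm 4]
        rw [e] at hdec
        linarith

lemma step_mem_sublevel (hprob : IsCompositeSCProblem b f g)
    {x0 : EuclideanSpace ℝ (Fin N)} (hx0 : x0 ∈ dom (objective b f g))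
    {x x' : EuclideanSpace ℝ (Fin N)} (hx : x ∈ sublevel (objective b f g) x0)
    {η : ℝ} (hη : η ∈ Icc (0 : ℝ) (1 / 4)) {i : Fin n} (hstep : IsStep b f g η x i x') :
    x' ∈ sublevel (objective b f g) x0 := by
  obtain ⟨d, hd, rfl⟩ := hstep
  have hxd := (hprob.mem_sublevel hx0).1 hx
  obtain ⟨h1, h2⟩ := step_decrease hprob hxd.1 hη hd rfl
  refine (hprob.mem_sublevel hx0).2 ⟨h1, h2.trans ?_⟩
  have h0 := weightedNorm_nonneg (diagBlk b i (hessian (re f) x)) d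
  have : 0 ≤ weightedNorm (diagBlk b i (hessian (re f) x)) d ^ 2
      / (4 * (1 + weightedNorm (diagBlk b i (hessian (re f) x)) d)) := by positivity
  linarith [hxd.2]

end Step

/-! ### The random sequence -/

section Random

variable {Ω : Type*} [MeasurableSpace Ω] {P : Measure Ω} {N n : ℕ}
  {b : Fin N → Fin n} {f : EuclideanSpace ℝ (Fin N) → EReal}
  {g : (i : Fin n) → Block b i → EReal} {η : ℝ} {p : Fin n → ℝ}
  {x0 : EuclideanSpace ℝ (Fin N)} {idx : ℕ → Ω → Fin n} {x : ℕ → Ω → EuclideanSpace ℝ (Fin N)}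

/-- The first `k` picks. -/
def hist (idx : ℕ → Ω → Fin n) (k : ℕ) (ω : Ω) : Fin k → Fin n := fun j => idx j ω

lemma IsGenerated.measurable_hist (hx : IsGenerated P b f g η p x0 idx x) (k : ℕ) :
    Measurable (hist idx k) := measurable_pi_lambda _ fun j => hx.measurable_idx j

lemma IsGenerated.prob_hist (hx : IsGenerated P b f g η p x0 idx x) (k : ℕ) (h : Fin k → Fin n) :
    P.real (hist idx k ⁻¹' {h}) = ∏ j, p (h j) := by
  have hind : iIndepFun (fun j : Fin k => idx j) P := hx.indep.precomp Fin.val_injective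
  have h1 := hind.measure_inter_preimage_eq_mul Finset.univ (sets := fun j => {h j})
    (fun j _ => measurableSet_singleton _)
  have e : hist idx k ⁻¹' {h} = ⋂ j ∈ Finset.univ, idx (j : Fin k) ⁻¹' {h j} := by
    ext ω
    simp [hist, funext_iff]
  rw [Measure.real, e, h1, ENNReal.toReal_prod]
  exact Finset.prod_congr rfl fun j _ => hx.law j (h j)

/-- Every finite sequence of picks has positive probability, hence actually occurs. Each history
therefore has a sample point at which the step relation can be read off. -/
lemma IsGenerated.exists_hist (hx : IsGenerated P b f g η p x0 idx x) (hp : ∀ i, 0 < p i)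
    (k : ℕ) (h : Fin k → Fin n) : ∃ ω, hist idx k ω = h := by
  by_contra! hne
  have h1 := hx.prob_hist k h
  have e : hist idx k ⁻¹' {h} = ∅ := by
    ext ω
    simp [hne ω]
  rw [e, measureReal_empty] at h1
  exact (Finset.prod_pos fun j _ => hp (h j)).ne h1

lemma IsGenerated.integral_hist [IsProbabilityMeasure P]
    (hx : IsGenerated P b f g η p x0 idx x) (k : ℕ)
    (G : (Fin k → Fin n) → ℝ) :
    Integrable (fun ω => G (hist idx k ω)) P ∧
      ∫ ω, G (hist idx k ω) ∂P = ∑ h, (∏ j, p (h j)) * G h := by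
  have hm := hx.measurable_hist k
  have : IsProbabilityMeasure (P.map (hist idx k)) :=
    Measure.isProbabilityMeasure_map hm.aemeasurable
  have hi : Integrable G (P.map (hist idx k)) := Integrable.of_finite
  refine ⟨hi.comp_measurable hm, ?_⟩
  rw [← integral_map hm.aemeasurable hi.aestronglyMeasurable, integral_fintype hi]
  refine Finset.sum_congr rfl fun h _ => ?_
  rw [map_measureReal_apply hm (measurableSet_singleton _), hx.prob_hist, smul_eq_mul]

lemma IsGenerated.eq_of_hist_eq (hx : IsGenerated P b f g η p x0 idx x) {k : ℕ} {ω ω' : Ω}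
    (h : hist idx k ω = hist idx k ω') : x k ω = x k ω' :=
  hx.adapted k ω ω' fun j hj => congrFun h ⟨j, hj⟩

/-- If a potential contracts on average over the choice of the block, its expectation decays
linearly along the random sequence. -/
lemma IsGenerated.integral_le [IsProbabilityMeasure P]
    (hx : IsGenerated P b f g η p x0 idx x) (hp : ∀ i, 0 < p i)
    {S : Set (EuclideanSpace ℝ (Fin N))} (hS : ∀ k ω, x k ω ∈ S)
    {φ : EuclideanSpace ℝ (Fin N) → ℝ} {q : ℝ} (hq : 0 ≤ q)
    (hdec : ∀ y ∈ S, ∀ y' : Fin n → EuclideanSpace ℝ (Fin N),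
      (∀ i, IsStep b f g η y i (y' i)) → ∑ i, p i * φ (y' i) ≤ q * φ y) (k : ℕ) :
    Integrable (fun ω => φ (x k ω)) P ∧ ∫ ω, φ (x k ω) ∂P ≤ q ^ k * φ x0 := by
  have hex := hx.exists_hist hp
  choose W hW using hex
  -- Choosing a representative sample point per history exhibits x^k as a function on a finite set,
  -- so no measurability of the iterates has to be assumed.
  have hfac : ∀ k, (fun ω => φ (x k ω)) = fun ω => φ (x k (W k (hist idx k ω))) := fun k => by
    funext ω
    rw [hx.eq_of_hist_eq (hW k (hist idx k ω))]
  have hint : ∀ k, ∫ ω, φ (x k ω) ∂P = ∑ h, (∏ j, p (h j)) * φ (x k (W k h)) := fun k => by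
    rw [hfac k]
    exact (hx.integral_hist k fun h => φ (x k (W k h))).2
  refine ⟨?_, ?_⟩
  · rw [hfac k]
    exact (hx.integral_hist k fun h => φ (x k (W k h))).1
  induction k with
  | zero => simp [hx.init]
  | succ k ih =>
    have hstep : ∫ ω, φ (x (k + 1) ω) ∂P ≤ q * ∫ ω, φ (x k ω) ∂P := by
      -- A history of length k+1 is split into its first k picks and the last one; the inner sum
      -- over the last pick is the one-step average.
      rw [hint, hint, ← (Fin.snocEquiv fun _ : Fin (k + 1) => Fin n).sum_comp,
        Fintype.sum_prod_type_right, Finset.mul_sum]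
      refine Finset.sum_le_sum fun h _ => ?_
      have hh : ∀ i, hist idx k (W (k + 1) (Fin.snoc h i)) = h := fun i => by
        funext j
        have := congrFun (hW (k + 1) (Fin.snoc h i)) j.castSucc
        rwa [Fin.snoc_castSucc] at this
      have hi : ∀ i, idx k (W (k + 1) (Fin.snoc h i)) = i := fun i => by
        have := congrFun (hW (k + 1) (Fin.snoc h i)) (Fin.last k)
        rwa [Fin.snoc_last] at this
      have hd := hdec (x k (W k h)) (hS k _)
        (fun i => x (k + 1) (W (k + 1) (Fin.snoc h i))) (fun i => by
          have := hx.step k (W (k + 1) (Fin.snoc h i))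
          rwa [hi, hx.eq_of_hist_eq ((hh i).trans (hW k h).symm)] at this)
      have hprod : 0 ≤ ∏ j, p (h j) := Finset.prod_nonneg fun j _ => (hp _).le
      calc _ = (∏ j, p (h j)) * ∑ i, p i * φ (x (k + 1) (W (k + 1) (Fin.snoc h i))) := by
            rw [Finset.mul_sum]
            refine Finset.sum_congr rfl fun i _ => ?_
            have e : (Fin.snocEquiv fun _ : Fin (k + 1) => Fin n) (i, h)
                = (Fin.snoc h i : Fin (k + 1) → Fin n) := rfl
            rw [e, Fin.prod_univ_castSucc]
            simp only [Fin.snoc_castSucc, Fin.snoc_last]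
            ring
        _ ≤ (∏ j, p (h j)) * (q * φ (x k (W k h))) := mul_le_mul_of_nonneg_left hd hprod
        _ = _ := by ring
    calc _ ≤ q * ∫ ω, φ (x k ω) ∂P := hstep
      _ ≤ q * (q ^ k * φ x0) := mul_le_mul_of_nonneg_left ih hq
      _ = _ := by ring

lemma IsGenerated.mem_sublevel (hx : IsGenerated P b f g η p x0 idx x)
    (hprob : IsCompositeSCProblem b f g) (hx0 : x0 ∈ dom (objective b f g))
    (hη : η ∈ Icc (0 : ℝ) (1 / 4)) (k : ℕ) (ω : Ω) :
    x k ω ∈ sublevel (objective b f g) x0 := by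
  induction k with
  | zero => rw [hx.init]; exact le_refl (objective b f g x0)
  | succ k ih => exact step_mem_sublevel hprob hx0 ih hη (hx.step k ω)

end Random

end RBPDN
end
-- The convergence theorem
theorem corollary4p1 {N n : ℕ} (hN : 0 < N) (b : Fin N → Fin n)
    (f : EuclideanSpace ℝ (Fin N) → EReal) (g : (i : Fin n) → RBPDN.Block b i → EReal)
    (hprob : RBPDN.IsCompositeSCProblem b f g)
    (x0 : EuclideanSpace ℝ (Fin N)) (hx0 : x0 ∈ RBPDN.dom (RBPDN.objective b f g))
    (η : ℝ) (hη : η ∈ Set.Icc (0 : ℝ) (1 / 4))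
    (p : Fin n → ℝ) (hp : ∀ i, 0 < p i) (hpsum : ∑ i, p i = 1)
    {Ω : Type*} [MeasurableSpace Ω] (P : MeasureTheory.Measure Ω)
    [MeasureTheory.IsProbabilityMeasure P]
    (idx : ℕ → Ω → Fin n) (x : ℕ → Ω → EuclideanSpace ℝ (Fin N))
    (hx : RBPDN.IsGenerated P b f g η p x0 idx x)
    (Lg : ℝ) (hLg : 0 ≤ Lg)
    (hg : RBPDN.IsLipschitzDifferentiableOn Lg (RBPDN.gSum b g)
      (RBPDN.sublevel (RBPDN.objective b f g) x0)) :
    let F := RBPDN.objective b f g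
    let S := RBPDN.sublevel F x0
    let Fstar : ℝ := (⨅ y, F y).toReal
    let δ0 : ℝ := (F x0).toReal - Fstar
    let c4 : ℝ := Real.sqrt n * RBPDN.c1 b f η S * RBPDN.sigmaF f S /
      ((1 - η) * (RBPDN.LF f S + Lg))
    let q : ℝ := RBPDN.rate c4 (⨅ i, p i) δ0
    q ∈ Set.Ioo (0 : ℝ) 1 ∧
    ∀ k : ℕ, (∀ ω, F (x k ω) ≠ ⊤) ∧
      MeasureTheory.Integrable (fun ω => (F (x k ω)).toReal - Fstar) P ∧
      ∫ ω, ((F (x k ω)).toReal - Fstar) ∂P ≤ q ^ k * ((F x0).toReal - Fstar) := by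
  intro F S Fstar δ0 c4 q
  have hNne : Nonempty (Fin N) := ⟨⟨0, hN⟩⟩
  have hnne : Nonempty (Fin n) := ⟨b ⟨0, hN⟩⟩
  obtain ⟨z, hz, -⟩ := hprob.existsUnique_min
  have hFz : Fstar = RBPDN.re F z := by
    have : ⨅ y, F y = F z := le_antisymm (iInf_le _ z) (le_iInf hz)
    simp only [Fstar, this, RBPDN.re]
  have hcomp := hprob.isCompact_sublevel hx0
  have hx0S : x0 ∈ S := le_refl (F x0)
  have hSd : ∀ y ∈ S, y ∈ RBPDN.dom F := fun y hy => ((hprob.mem_sublevel hx0).1 hy).1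
  have hSf : S ⊆ RBPDN.dom f := fun y hy => (hprob.mem_dom.1 (hSd y hy)).1
  have hpd : ∀ y ∈ S, (RBPDN.hessian (RBPDN.re f) y).PosDef := fun y hy =>
    hprob.posDef y (hSd y hy)
  have hsc := hprob.selfConcordant
  obtain ⟨hσ, hσle⟩ := RBPDN.sigmaF_pos_and_le hN hsc hcomp ⟨x0, hx0S⟩ hSf hpd
  have hL := RBPDN.hessQuad_le_LF hsc hcomp hSf
  have hM := RBPDN.condTerm_le_sSup (b := b) hN hsc hcomp ⟨x0, hx0S⟩ hSf hpd hη.1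
  set σ := RBPDN.sigmaF f S with hσdef
  set L := RBPDN.LF f S with hLdef
  set M := sSup (RBPDN.condTerm b f η '' S) with hMdef
  have hM1 : 1 ≤ M := (RBPDN.one_le_condTerm (hpd x0 hx0S) hη.1).trans (hM x0 hx0S)
  have hσL : σ ≤ L := by
    have h1 := hL x0 hx0S (EuclideanSpace.single ⟨0, hN⟩ 1)
    have h2 := hσle x0 hx0S (EuclideanSpace.single ⟨0, hN⟩ 1)
    simp at h1 h2
    linarith
  have hη1 : 0 < 1 - η := by linarith [hη.2]
  have hn : 0 < Real.sqrt n := Real.sqrt_pos.2 (by exact_mod_cast Fin.pos_iff_nonempty.2 hnne)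
  have hLpos : 0 < L + Lg := by linarith
  -- The factors √n and 1-η in c̃₄ cancel those in c₁, which gives the form 1/(KM) used in the gap
  -- estimate.
  have hc4 : c4 = σ / (M * (L + Lg)) := by
    have h1 : RBPDN.c1 b f η S = (1 - η) / (Real.sqrt n * M) := rfl
    simp only [c4, h1, ← hσdef, ← hLdef]
    field_simp
  have hc0 : 0 < c4 := by rw [hc4]; positivity
  have hc1 : c4 ≤ 1 := by
    rw [hc4, div_le_one (by positivity)]
    calc σ ≤ L + Lg := by linarith
      _ ≤ M * (L + Lg) := le_mul_of_one_le_left hLpos.le hM1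
  have hPp : ∀ i, ⨅ j, p j ≤ p i := fun i => ciInf_le (Set.finite_range p).bddBelow i
  have hP : 0 < ⨅ j, p j := by
    obtain ⟨i, hi⟩ := exists_eq_ciInf_of_finite (f := p)
    rw [← hi]
    exact hp i
  have hP1 : ⨅ j, p j ≤ 1 := by
    obtain ⟨i⟩ := hnne
    refine (hPp i).trans ?_
    rw [← hpsum]
    exact Finset.single_le_sum (fun j _ => (hp j).le) (Finset.mem_univ i)
  have hδ0 : 0 ≤ δ0 := by
    have := ((hprob.mem_sublevel hx0).1 (hz x0)).2
    simp only [δ0, hFz]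
    exact sub_nonneg.2 this
  have hq := RBPDN.rate_mem_Ioo hc0 hc1 hP hP1 hδ0
  refine ⟨hq, fun k => ?_⟩
  have hmem := hx.mem_sublevel hprob hx0 hη
  refine ⟨fun ω => hSd _ (hmem k ω), ?_⟩
  refine hx.integral_le hp hmem (φ := fun y => (F y).toReal - Fstar) hq.1.le
    (fun y hy y' hstep => ?_) k
  have := RBPDN.expected_decrease hN hprob hx0 hLg hg hσ hL hσle hη hM hc4 hp hpsum hP hPp hz hy
    hstep
  rw [← hFz] at this
  exact this
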